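/- **The model.** For $m\ge 2$ let $h_{m-1}=\sum_{i=1}^{m-1}\frac1i$ and $$q(m,i)=\frac{m}{2h_{m-1}}\cdot\frac{1}{i(m-i)},\qquad 1\le i\le m-1 .$$ The critical beta-splitting random tree on $n$ leaves is built from an interval of size $n$ as follows: an interval of size $m\ge2$ is held for an Exponential($h_{m-1}$) time (that is, of rate $h_{m-1}$) and is then split into a left interval of random size $i$, with probability $q(m,i)$, and a right interval of size $m-i$; the two parts evolve independently, in the same way, and independently of the holding time. Intervals of size $1$ are the leaves. The time-height of a leaf is the time at which it appears, i.e. the sum of the holding times of the intervals on the path from the root to it. Let $D_n$ be the time-height of a leaf chosen uniformly at random from the $n$ leaves, and let $\zeta$ be the Riemann zeta function. Asymptotics are as $n\to\infty$. **Theorem.** For every $n\ge2$ the random variable $D_n$ is square integrable, and: 1. for all $n\ge 2$, $\ \zeta(2)^{-1}\log n\le \mathbb E[D_n]\le 1+\log(n-1)$; 2. $\mathbb E[D_n]=\zeta(2)^{-1}\log n+O(1)$; 3. $\operatorname{var}(D_n)=(1+o(1))\,\dfrac{2\zeta(3)}{\zeta(2)^3}\log n$; 4. (conditional part) let $c_0,c_1\in\mathbb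 R$ and $1<r\le 2$ be such that $$\mathbb E[D_n]=\zeta(2)^{-1}\log n+c_0+c_1n^{-1}+O(n^{-r}).\qquad(\ast)$$ Then $$\mathbb E[D_n]=\zeta(2)^{-1}\log n+c_0-\frac{1}{2\zeta(2)}\,n^{-1}+O(n^{-r}) \qquad\text{and}\qquad \operatorname{var}(D_n)=\frac{2\zeta(3)}{\zeta(2)^3}\log n+O(1).$$ In particular, if the "$h$-ansatz" holds, namely that $\mathbb E[D_n]$ has an expansion $\zeta(2)^{-1}\log n+\sum_{j\ge0}c_jn^{-j}$ in powers of $n^{-1}$, then $(\ast)$ holds with $r=2$, so that $\mathbb E[D_n]=\zeta(2)^{-1}\log n+c_0-\frac{1}{2\zeta(2)}n^{-1}+O(n^{-2})$ and $\operatorname{var}(D_n)=\frac{2\zeta(3)}{\zeta(2)^3}\log n+O(1)$. -/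

import Mathlib

open MeasureTheory ProbabilityTheory Filter Asymptotics

noncomputable section

namespace BetaSplitting

/-- The harmonic number `h_m = ∑_{i=1}^m 1/i`. -/
def h (m : ℕ) : ℝ := (harmonic m : ℝ)

/-- The critical beta-splitting probabilities `q(m,i) = m / (2 h_{m-1}) · 1 / (i (m-i))`,
for `1 ≤ i ≤ m - 1`. -/
def q (m i : ℕ) : ℝ := (m : ℝ) / (2 * h (m - 1)) * (1 / ((i : ℝ) * ((m : ℝ) - (i : ℝ))))

/-- Finite binary trees in continuous time: either a leaf (an interval of size one), or an interval
that is split, after a holding time `t`, into a left subtree `l` and a right subtree `r`. -/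
inductive TimedTree : Type
  | leaf : TimedTree
  | split (t : ℝ) (l r : TimedTree) : TimedTree

namespace TimedTree

/-- The shape of a timed tree: the binary tree without the holding times. -/
def shape : TimedTree → BinaryTree Unit
  | leaf => BinaryTree.nil
  | split _ l r => BinaryTree.node () l.shape r.shape

/-- The holding time at the node reached from the root by a sequence of left (`false`) and right
(`true`) turns; it is `0` where there is no internal node. -/
def holdingTime : TimedTree → List Bool → ℝ
  | leaf, _ => 0
  | split t _ _, [] => t
  | split _ l _, false :: a => l.holdingTime a
  | split _ _ r, true :: a => r.holdingTime a

/-- The σ-algebra generated by the (discrete) shape and by the (real) holding times. -/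
instance : MeasurableSpace TimedTree :=
  MeasurableSpace.comap shape ⊤ ⊔ MeasurableSpace.comap holdingTime MeasurableSpace.pi

/-- The time-heights of the leaves, from left to right. The time-height of a leaf is the sum of the
holding times of the intervals on the path from the root to it. -/
def leafHeights : TimedTree → List ℝ
  | leaf => [0]
  | split t l r => (l.leafHeights ++ r.leafHeights).map (fun s => t + s)

end TimedTree

/-- The law of the critical beta-splitting random tree on `n` leaves, in continuous time: an
interval of size `m ≥ 2` is held for an Exponential(`h_{m-1}`) time and then splits into a left
interval of random size `i`, with probability `q(m,i)`, and a right interval of size `m - i`, which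
evolve independently in the same way; intervals of size `1` are leaves.
(In the code `m = n + 2` and the left interval has size `i + 1`. The value at `0` is immaterial.) -/
def treeLaw : ℕ → Measure TimedTree
  | 0 => Measure.dirac TimedTree.leaf
  | 1 => Measure.dirac TimedTree.leaf
  | n + 2 => ∑ i : Fin (n + 1), ENNReal.ofReal (q (n + 2) (i.1 + 1)) •
      ((expMeasure (h (n + 1))).prod ((treeLaw (i.1 + 1)).prod (treeLaw (n + 1 - i.1)))).map
        (fun x => TimedTree.split x.1 x.2.1 x.2.2)
  termination_by n => n
  decreasing_by all_goals omega

/-- The joint law of the random tree on `n` leaves and of the number of an independent uniform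
random leaf; the leaves are numbered `0, …, n - 1` from left to right. -/
def leafLaw (n : ℕ) : Measure (TimedTree × Fin n) :=
  (treeLaw n).prod (uniformOn Set.univ)

/-- The time-height `D_n` of the random leaf. (A tree on `n` leaves has exactly `n` leaf heights;
the default value `0` is only used on a null set.) -/
def D (n : ℕ) (x : TimedTree × Fin n) : ℝ := x.1.leafHeights.getD x.2.1 0

/-- The expected value `𝔼[D_n]`. -/
def meanD (n : ℕ) : ℝ := ∫ x, D n x ∂(leafLaw n)

/-- The variance `var(D_n)`. -/
def varD (n : ℕ) : ℝ := variance (D n) (leafLaw n)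

/-- The value `ζ(s)` of the Riemann zeta function, as a real number, for an integer `s ≥ 2`. -/
def zeta (s : ℕ) : ℝ := (riemannZeta s).re

/-- The expansion `𝔼[D_n] = ζ(2)⁻¹ log n + c₀ + c₁ n⁻¹ + O(n⁻ʳ)`. The full `h`-ansatz, that
`𝔼[D_n] = ζ(2)⁻¹ log n + ∑_{j ≥ 0} c_j n⁻ʲ`, contains this for `r = 2`. -/
def HExpansion (c₀ c₁ r : ℝ) : Prop :=
  (fun n : ℕ => meanD n - ((zeta 2)⁻¹ * Real.log n + c₀ + c₁ * (n : ℝ)⁻¹))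
    =O[atTop] fun n : ℕ => (n : ℝ) ^ (-r)

end BetaSplitting

end

/-!
Consider the sizes of the successive intervals that contain a random leaf. By
`BetaSplitting.q_mul_cast` they form a Markov chain which jumps from `n` to `i < n` at rate
`1 / (n - i)`; let `L f n = ∑ (f n - f i) / (n - i)`, the sum being over `1 ≤ i < n`
(`BetaSplitting.splitOp`). Conditioning on the first split gives `L 𝔼[D] = 1` and
`L 𝔼[D²] = 2 𝔼[D]`, whence `L var(D) n = ∑ (𝔼[D_n] - 𝔼[D_i])² / (n - i)`
(`BetaSplitting.splitOp_meanD`, `BetaSplitting.splitOp_varD`). As `L` satisfies a comparison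
principle (`BetaSplitting.le_of_splitOp_le_splitOp`), it suffices to apply `L` to explicit functions.

* `L log n` is a Riemann sum of `-log (1 - x) / x`, whose integral over `[0, 1]` is `ζ(2)`. The power
  series gives `L log ≤ ζ(2)`, and with Stirling's formula `L log n = ζ(2) - log n / (2 n) + O(1 / n)`
  (`BetaSplitting.exists_abs_splitOp_log_sub`).
* `-1 / √n` is a bounded function with `L (-1 / √n) ≥ 1 / (4 √n)`, so that `f` is bounded as soon as
  `L f = O(1 / √n)` (`BetaSplitting.abs_le_of_abs_splitOp_le`). This applies to the deviation
  `e n = 𝔼[D_n] - ζ(2)⁻¹ log n`.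
* `∑ (log n - log i)² / (n - i)` is a Riemann sum of `log² y / (1 - y)`, whose integral is `2 ζ(3)`
  (`BetaSplitting.abs_logSqSum_sub`).

For the variance, `𝔼[D_n] - 𝔼[D_i] = ζ(2)⁻¹ (log n - log i) + (e n - e i)` is squared. The squares of
the logarithms produce the leading term. No regularity of `e` is needed to control the rest: the
identity `∑ (e n - e i)² / (n - i) = 2 e n * L e n - L (e²) n` shows that the quadratic term is a small
term plus the image under `L` of a bounded function, which contributes `O(1)` to the variance, and
the cross term is bounded by a small multiple of the leading term and a multiple of the quadratic one
(`BetaSplitting.exists_abs_varD_sub_le`).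

If the mean has an expansion up to `O(n⁻ʳ)` with `r > 1`, the remainder contributes `O(1 / n)` to the
recursion (`BetaSplitting.exists_mul_abs_splitOp_le`), and since `L (1 / n) = -h_{n-1} / n`, comparing
the terms of order `log n / n` forces `c₁ = -1 / (2 ζ(2))`. Moreover `e n - e i = O(1 / i)` then makes
the cross terms `O(1 / √n)`, so that the variance is known up to a bounded error.
-/

namespace BetaSplitting

/-! ### Measurability of the leaf heights -/

theorem sum_map_eq_sum_getD (l : List ℝ) (g : ℝ → ℝ) :
    (l.map g).sum = ∑ k ∈ Finset.range l.length, g (l.getD k 0) := by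
  induction l with
  | nil => simp
  | cons a l ih =>
    rw [List.map_cons, List.sum_cons, ih, List.length_cons, Finset.sum_range_succ']
    simp [add_comm]

namespace TimedTree

/-- An injective numbering of the shapes, by iterating the pairing function. -/
def encodeShape : BinaryTree Unit → ℕ
  | .nil => 0
  | .node _ l r => Nat.pair (encodeShape l) (encodeShape r) + 1

theorem encodeShape_injective : Function.Injective encodeShape := by
  intro s
  induction s with
  | nil => intro s' hs; cases s' <;> simp_all [encodeShape]
  | node v l r hl hr =>
    intro s' hs
    cases s' with
    | nil => simp [encodeShape] at hs
    | node v' l' r' =>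
      simp only [encodeShape, Nat.add_right_cancel_iff, Nat.pair_eq_pair] at hs
      rw [hl hs.1, hr hs.2]

instance : Countable (BinaryTree Unit) := encodeShape_injective.countable

theorem measurable_shape : Measurable[_, ⊤] shape :=
  Measurable.of_comap_le le_sup_left

theorem measurable_holdingTime : Measurable holdingTime :=
  Measurable.of_comap_le le_sup_right

/-- A function of the shape and of the holding times is measurable as soon as it is so for each
of the countably many shapes. -/
theorem measurable_of_shape {β : Type*} [MeasurableSpace β]
    (F : BinaryTree Unit → (List Bool → ℝ) → β) (hF : ∀ s, Measurable (F s)) :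
    Measurable fun x : TimedTree => F x.shape x.holdingTime := by
  let _ : MeasurableSpace (BinaryTree Unit) := ⊤
  have h1 : Measurable fun p : BinaryTree Unit × (List Bool → ℝ) => F p.1 p.2 :=
    measurable_from_prod_countable_right hF
  exact h1.comp (measurable_shape.prodMk measurable_holdingTime)

theorem measurable_split :
    Measurable fun x : ℝ × TimedTree × TimedTree => split x.1 x.2.1 x.2.2 := by
  refine Measurable.of_comap_le ?_
  change MeasurableSpace.comap _ (_ ⊔ _) ≤ _
  rw [MeasurableSpace.comap_sup, MeasurableSpace.comap_comp, MeasurableSpace.comap_comp]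
  refine sup_le (Measurable.comap_le ?_) (Measurable.comap_le ?_)
  · let _ : MeasurableSpace (BinaryTree Unit) := ⊤
    have h1 : Measurable fun p : BinaryTree Unit × BinaryTree Unit => BinaryTree.node () p.1 p.2 :=
      measurable_of_countable _
    exact h1.comp ((measurable_shape.comp (measurable_fst.comp measurable_snd)).prodMk
      (measurable_shape.comp (measurable_snd.comp measurable_snd)))
  · refine measurable_pi_iff.2 fun a => ?_
    cases a with
    | nil => exact measurable_fst
    | cons b a =>
      cases b
      · exact (measurable_pi_iff.1 measurable_holdingTime a).comp
          (measurable_fst.comp measurable_snd)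
      · exact (measurable_pi_iff.1 measurable_holdingTime a).comp
          (measurable_snd.comp measurable_snd)

/-- The leaf heights as a function of the shape and of the holding times. -/
def heightsOf : BinaryTree Unit → (List Bool → ℝ) → List ℝ
  | .nil, _ => [0]
  | .node _ l r, τ =>
    (heightsOf l (fun a => τ (false :: a)) ++ heightsOf r (fun a => τ (true :: a))).map
      (fun s => τ [] + s)

theorem leafHeights_eq_heightsOf (x : TimedTree) :
    x.leafHeights = heightsOf x.shape x.holdingTime := by
  induction x with
  | leaf => rfl
  | split t l r hl hr =>
    simp only [leafHeights, shape, heightsOf, holdingTime]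
    rw [hl, hr]

theorem length_heightsOf (s : BinaryTree Unit) :
    ∀ τ τ' : List Bool → ℝ, (heightsOf s τ).length = (heightsOf s τ').length := by
  induction s with
  | nil => intro τ τ'; rfl
  | node v l r hl hr =>
    intro τ τ'
    simp only [heightsOf, List.length_map, List.length_append]
    rw [hl _ (fun a => τ' (false :: a)), hr _ (fun a => τ' (true :: a))]

theorem measurable_getD_heightsOf (s : BinaryTree Unit) :
    ∀ k : ℕ, Measurable fun τ => (heightsOf s τ).getD k 0 := by
  induction s with
  | nil => intro k; simp only [heightsOf]; exact measurable_const
  | node v l r hl hr =>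
    intro k
    have hlen := length_heightsOf l
    -- the number of leaves of a subtree does not depend on the holding times
    have e : (fun τ => (heightsOf (.node v l r) τ).getD k 0) = fun τ =>
        if k < (heightsOf l (fun _ => 0)).length then
          τ [] + (heightsOf l (fun a => τ (false :: a))).getD k 0
        else if k < (heightsOf l (fun _ => 0)).length + (heightsOf r (fun _ => 0)).length then
          τ [] + (heightsOf r (fun a => τ (true :: a))).getD
            (k - (heightsOf l (fun _ => 0)).length) 0
        else 0 := by
      funext τ
      have h1 := hlen (fun a => τ (false :: a)) (fun _ => 0)
      have h2 := length_heightsOf r (fun a => τ (true :: a)) (fun _ => 0)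
      simp only [heightsOf, List.getD_eq_getElem?_getD]
      split_ifs with c1 c2
      · rw [List.getElem?_map, List.getElem?_append_left (by omega),
          List.getElem?_eq_getElem (by omega)]
        simp
      · rw [List.getElem?_map, List.getElem?_append_right (by omega), h1,
          List.getElem?_eq_getElem (by omega)]
        simp
      · rw [List.getElem?_eq_none (by simp; omega)]
        simp
    rw [e]
    have m1 : Measurable fun τ : List Bool → ℝ => fun a => τ (false :: a) :=
      measurable_pi_iff.2 fun a => measurable_pi_apply _
    have m2 : Measurable fun τ : List Bool → ℝ => fun a => τ (true :: a) :=
      measurable_pi_iff.2 fun a => measurable_pi_apply _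
    split_ifs
    · exact (measurable_pi_apply _).add ((hl k).comp m1)
    · exact (measurable_pi_apply _).add ((hr _).comp m2)
    · exact measurable_const

theorem measurable_getD_leafHeights (k : ℕ) :
    Measurable fun x : TimedTree => x.leafHeights.getD k 0 := by
  simp only [leafHeights_eq_heightsOf]
  exact measurable_of_shape (fun s τ => (heightsOf s τ).getD k 0)
    fun s => measurable_getD_heightsOf s k

theorem measurable_length_leafHeights :
    Measurable fun x : TimedTree => x.leafHeights.length := by
  simp only [leafHeights_eq_heightsOf]
  refine measurable_of_shape (fun s τ => (heightsOf s τ).length) fun s => ?_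
  simp only [length_heightsOf s _ (fun _ => 0)]
  exact measurable_const

/-- The sum of the `p`-th powers of the leaf heights. -/
def powerSum (p : ℕ) (x : TimedTree) : ℝ := (x.leafHeights.map (fun s => s ^ p)).sum

theorem powerSum_eq (p : ℕ) (x : TimedTree) :
    x.powerSum p = ∑ k ∈ Finset.range x.leafHeights.length, (x.leafHeights.getD k 0) ^ p :=
  sum_map_eq_sum_getD _ _

theorem measurable_powerSum (p : ℕ) : Measurable (powerSum p) := by
  have e : powerSum p = fun x : TimedTree =>
      ∑ k ∈ Finset.range x.leafHeights.length, (x.leafHeights.getD k 0) ^ p :=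
    funext (powerSum_eq p)
  rw [e]
  have h1 : Measurable fun y : TimedTree × ℕ =>
      ∑ k ∈ Finset.range y.2, (y.1.leafHeights.getD k 0) ^ p := by
    refine measurable_from_prod_countable_left fun n => ?_
    exact Finset.measurable_fun_sum (Finset.range n)
      fun k _ => (measurable_getD_leafHeights k).pow_const p
  exact h1.comp (measurable_id.prodMk measurable_length_leafHeights)

theorem powerSum_one_split (t : ℝ) (l r : TimedTree) :
    (split t l r).powerSum 1 =
      (l.leafHeights.length + r.leafHeights.length) * t + (l.powerSum 1 + r.powerSum 1) := by
  have key : ∀ L : List ℝ, (L.map fun s => t + s).sum = L.length * t + L.sum := by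
    intro L
    induction L with
    | nil => simp
    | cons a L ih => simp [ih]; ring
  simp only [powerSum, leafHeights, pow_one, List.map_id', List.map_append, List.sum_append, key]
  ring

theorem powerSum_two_split (t : ℝ) (l r : TimedTree) :
    (split t l r).powerSum 2 =
      (l.leafHeights.length + r.leafHeights.length) * t ^ 2
        + 2 * (t * (l.powerSum 1 + r.powerSum 1)) + (l.powerSum 2 + r.powerSum 2) := by
  have key : ∀ L : List ℝ, ((L.map fun s => t + s).map fun s => s ^ 2).sum
      = L.length * t ^ 2 + 2 * (t * (L.map fun s => s ^ 1).sum)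
        + (L.map fun s => s ^ 2).sum := by
    intro L
    induction L with
    | nil => simp
    | cons a L ih =>
      rw [List.map_cons, List.map_cons, List.sum_cons, ih]
      simp
      ring
  simp only [powerSum, leafHeights, List.map_append, List.sum_append, key]
  ring

theorem length_leafHeights_split (t : ℝ) (l r : TimedTree) :
    (split t l r).leafHeights.length = l.leafHeights.length + r.leafHeights.length := by
  simp [leafHeights]

end TimedTree

/-! ### The exponential law -/

theorem expMeasure_eq_withDensity (r : ℝ) :
    expMeasure r = volume.withDensity fun x => ENNReal.ofReal (gammaPDFReal 1 r x) := rfl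

/-- The `k`-th moment of the exponential law of rate `r` is `k! / r ^ k`. -/
theorem expMeasure_moment {r : ℝ} (hr : 0 < r) (k : ℕ) :
    Integrable (fun x : ℝ => x ^ k) (expMeasure r) ∧
      ∫ x, x ^ k ∂(expMeasure r) = k.factorial / r ^ k := by
  have hI := Real.integral_rpow_mul_exp_neg_mul_Ioi (a := (k : ℝ) + 1) (by positivity) hr
  have hint : IntegrableOn (fun x : ℝ => x ^ ((k : ℝ) + 1 - 1) * Real.exp (-(r * x)))
      (Set.Ioi 0) := by
    refine .of_integral_ne_zero ?_
    rw [hI]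
    have := Real.Gamma_pos_of_pos (s := (k : ℝ) + 1) (by positivity)
    positivity
  have hg : ∀ x : ℝ, (ENNReal.ofReal (gammaPDFReal 1 r x)).toReal • x ^ k
      = Set.indicator (Set.Ici 0)
        (fun x => r * (x ^ ((k : ℝ) + 1 - 1) * Real.exp (-(r * x)))) x := by
    intro x
    rw [ENNReal.toReal_ofReal (gammaPDFReal_nonneg one_pos hr x)]
    by_cases hx : 0 ≤ x
    · rw [Set.indicator_of_mem (by exact hx), gammaPDFReal, if_pos hx]
      simp
      ring
    · rw [Set.indicator_of_notMem (by exact hx), gammaPDFReal, if_neg hx]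
      simp
  have hm : Measurable fun x => ENNReal.ofReal (gammaPDFReal 1 r x) :=
    (measurable_gammaPDFReal 1 r).ennreal_ofReal
  rw [expMeasure_eq_withDensity]
  constructor
  · rw [integrable_withDensity_iff_integrable_smul' hm (by simp)]
    simp only [hg]
    rw [integrable_indicator_iff measurableSet_Ici, integrableOn_Ici_iff_integrableOn_Ioi]
    exact hint.const_mul r
  · rw [integral_withDensity_eq_integral_toReal_smul hm (by simp)]
    simp only [hg]
    rw [integral_indicator measurableSet_Ici, integral_Ici_eq_integral_Ioi,
      integral_const_mul, hI, Real.Gamma_nat_eq_factorial, Real.rpow_add_one (by positivity),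
      Real.rpow_natCast, div_pow, one_pow]
    field_simp

/-! ### The splitting probabilities -/

theorem h_eq_sum (m : ℕ) : h m = ∑ i ∈ Finset.range m, 1 / ((i : ℝ) + 1) := by
  simp [h, harmonic]

theorem h_pos {m : ℕ} (hm : 1 ≤ m) : 0 < h m := by
  have := harmonic_pos (n := m) (by omega)
  simpa [h] using this

theorem sum_one_div_sub (n : ℕ) :
    ∑ i ∈ Finset.Ico 1 n, 1 / ((n : ℝ) - i) = h (n - 1) := by
  rw [h_eq_sum, Finset.sum_Ico_eq_sum_range, ← Finset.sum_range_reflect]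
  refine Finset.sum_congr rfl fun i hi => ?_
  have hi' := Finset.mem_range.1 hi
  have e : (n : ℝ) = ((1 + (n - 1 - 1 - i) : ℕ) : ℝ) + (i + 1) := by
    norm_cast; omega
  rw [e]
  congr 1
  push_cast
  ring

theorem sum_one_div (n : ℕ) : ∑ i ∈ Finset.Ico 1 n, 1 / (i : ℝ) = h (n - 1) := by
  rw [h_eq_sum, Finset.sum_Ico_eq_sum_range]
  refine Finset.sum_congr rfl fun i _ => ?_
  push_cast
  rw [add_comm]

theorem cast_sub_pos {n i : ℕ} (hi : i ∈ Finset.Ico 1 n) : (0 : ℝ) < (n : ℝ) - i := by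
  have : (i : ℝ) < n := by exact_mod_cast (Finset.mem_Ico.1 hi).2
  linarith

theorem cast_pos_of_mem {n i : ℕ} (hi : i ∈ Finset.Ico 1 n) : (0 : ℝ) < (i : ℝ) := by
  exact_mod_cast (Finset.mem_Ico.1 hi).1

theorem q_nonneg {m i : ℕ} (hi : i ∈ Finset.Ico 1 m) : 0 ≤ q m i := by
  have h1 := cast_sub_pos hi
  have h2 := cast_pos_of_mem hi
  have h3 : 0 < h (m - 1) := h_pos (by have := Finset.mem_Ico.1 hi; omega)
  unfold q
  positivity

theorem sum_reflect (m : ℕ) (X : ℕ → ℝ) :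
    ∑ i ∈ Finset.Ico 1 m, X (m - i) = ∑ i ∈ Finset.Ico 1 m, X i := by
  refine Finset.sum_nbij' (fun i => m - i) (fun i => m - i) ?_ ?_ ?_ ?_ ?_ <;>
    intro i hi <;> simp only [Finset.mem_Ico] at hi ⊢ <;> omega

theorem q_symm {m i : ℕ} (hi : i ∈ Finset.Ico 1 m) : q m (m - i) = q m i := by
  have hi' := Finset.mem_Ico.1 hi
  rw [q, q, Nat.cast_sub hi'.2.le, sub_sub_cancel, mul_comm (i : ℝ)]

theorem sum_q_mul_reflect (m : ℕ) (X : ℕ → ℝ) :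
    ∑ i ∈ Finset.Ico 1 m, q m i * X (m - i) = ∑ i ∈ Finset.Ico 1 m, q m i * X i := by
  rw [← sum_reflect m fun i => q m i * X i]
  exact Finset.sum_congr rfl fun i hi => by rw [q_symm hi]

/-- The size of the part that contains a uniform random leaf is `i` with probability
`1 / (h_{m-1} (m - i))`. -/
theorem q_mul_cast {m i : ℕ} (hi : i ∈ Finset.Ico 1 m) :
    q m i * i = m / (2 * h (m - 1)) * (1 / ((m : ℝ) - i)) := by
  have h1 := (cast_sub_pos hi).ne'
  have h2 := (cast_pos_of_mem hi).ne'
  unfold q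
  field_simp

theorem sum_q {m : ℕ} (hm : 2 ≤ m) : ∑ i ∈ Finset.Ico 1 m, q m i = 1 := by
  have h3 : 0 < h (m - 1) := h_pos (by omega)
  have hm' : (0 : ℝ) < m := by exact_mod_cast (by omega : 0 < m)
  have e : ∑ i ∈ Finset.Ico 1 m, q m i
      = ∑ i ∈ Finset.Ico 1 m, 1 / (2 * h (m - 1)) * (1 / ((m : ℝ) - i) + 1 / (i : ℝ)) := by
    refine Finset.sum_congr rfl fun i hi => ?_
    have h1 := (cast_sub_pos hi).ne'
    have h2 := (cast_pos_of_mem hi).ne'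
    unfold q
    field_simp
    ring
  rw [e, ← Finset.mul_sum, Finset.sum_add_distrib, sum_one_div_sub, sum_one_div]
  field_simp
  ring

/-! ### Moments of the tree law -/

/-- A law of trees with almost surely `n` leaves, for which the sums of the first and second powers
of the leaf heights are integrable. -/
structure IsRegular (μ : Measure TimedTree) (n : ℕ) : Prop where
  prob : IsProbabilityMeasure μ
  length : ∀ᵐ x ∂μ, x.leafHeights.length = n
  integrable_one : Integrable (TimedTree.powerSum 1) μ
  integrable_two : Integrable (TimedTree.powerSum 2) μ

/-- The law of a tree that splits, after an exponential holding time, into two independent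
subtrees. -/
noncomputable def nodeLaw (r : ℝ) (A B : Measure TimedTree) : Measure TimedTree :=
  ((expMeasure r).prod (A.prod B)).map (fun x => TimedTree.split x.1 x.2.1 x.2.2)

theorem nodeLaw_moments {r : ℝ} (hr : 0 < r) {A B : Measure TimedTree} {i j : ℕ}
    (hA : IsRegular A i) (hB : IsRegular B j) :
    IsRegular (nodeLaw r A B) (i + j) ∧
    ∫ x, x.powerSum 1 ∂(nodeLaw r A B)
      = (i + j) / r + (∫ x, x.powerSum 1 ∂A + ∫ x, x.powerSum 1 ∂B) ∧
    ∫ x, x.powerSum 2 ∂(nodeLaw r A B)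
      = 2 * (i + j) / r ^ 2 + 2 / r * (∫ x, x.powerSum 1 ∂A + ∫ x, x.powerSum 1 ∂B)
        + (∫ x, x.powerSum 2 ∂A + ∫ x, x.powerSum 2 ∂B) := by
  have := hA.prob
  have := hB.prob
  have := isProbabilityMeasure_expMeasure hr
  have hlen : ∀ᵐ x ∂((expMeasure r).prod (A.prod B)),
      x.2.1.leafHeights.length = i ∧ x.2.2.leafHeights.length = j := by
    refine Measure.quasiMeasurePreserving_snd.ae (p := fun y : TimedTree × TimedTree =>
      y.1.leafHeights.length = i ∧ y.2.leafHeights.length = j) ?_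
    filter_upwards [Measure.quasiMeasurePreserving_fst.ae hA.length,
      Measure.quasiMeasurePreserving_snd.ae hB.length] with y h1 h2 using ⟨h1, h2⟩
  have hm := TimedTree.measurable_split
  obtain ⟨i1, e1⟩ := expMeasure_moment hr 1
  obtain ⟨i2, e2⟩ := expMeasure_moment hr 2
  simp only [pow_one] at i1 e1
  -- sums over the two subtrees, for the product of their laws
  have iS : ∀ p, Integrable (TimedTree.powerSum p) A → Integrable (TimedTree.powerSum p) B →
      Integrable (fun y : TimedTree × TimedTree => y.1.powerSum p + y.2.powerSum p)
        (A.prod B) ∧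
      ∫ y, (y.1.powerSum p + y.2.powerSum p) ∂(A.prod B)
        = ∫ x, x.powerSum p ∂A + ∫ x, x.powerSum p ∂B := by
    intro p h1 h2
    refine ⟨(h1.comp_fst B).add (h2.comp_snd A), ?_⟩
    rw [integral_add (h1.comp_fst B) (h2.comp_snd A), integral_fun_fst, integral_fun_snd]
    simp
  obtain ⟨iS1, eS1⟩ := iS 1 hA.integrable_one hB.integrable_one
  obtain ⟨iS2, eS2⟩ := iS 2 hA.integrable_two hB.integrable_two
  have a1 : (fun x : ℝ × TimedTree × TimedTree => (TimedTree.split x.1 x.2.1 x.2.2).powerSum 1)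
      =ᵐ[(expMeasure r).prod (A.prod B)]
      fun x => (i + j) * x.1 + (x.2.1.powerSum 1 + x.2.2.powerSum 1) := by
    filter_upwards [hlen] with x hx
    rw [TimedTree.powerSum_one_split, hx.1, hx.2]
  have a2 : (fun x : ℝ × TimedTree × TimedTree => (TimedTree.split x.1 x.2.1 x.2.2).powerSum 2)
      =ᵐ[(expMeasure r).prod (A.prod B)]
      fun x => ((i + j) * x.1 ^ 2 + 2 * (x.1 * (x.2.1.powerSum 1 + x.2.2.powerSum 1)))
        + (x.2.1.powerSum 2 + x.2.2.powerSum 2) := by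
    filter_upwards [hlen] with x hx
    rw [TimedTree.powerSum_two_split, hx.1, hx.2]
  have j1 : Integrable (fun x : ℝ × TimedTree × TimedTree => ((i : ℝ) + j) * x.1)
      ((expMeasure r).prod (A.prod B)) := (i1.comp_fst _).const_mul _
  have j2 : Integrable (fun x : ℝ × TimedTree × TimedTree => ((i : ℝ) + j) * x.1 ^ 2)
      ((expMeasure r).prod (A.prod B)) := (i2.comp_fst _).const_mul _
  have j3 : Integrable (fun x : ℝ × TimedTree × TimedTree =>
      2 * (x.1 * (x.2.1.powerSum 1 + x.2.2.powerSum 1)))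
      ((expMeasure r).prod (A.prod B)) := (i1.mul_prod iS1).const_mul 2
  have j4 := iS1.comp_snd (expMeasure r)
  have j5 := iS2.comp_snd (expMeasure r)
  refine ⟨⟨Measure.isProbabilityMeasure_map hm.aemeasurable, ?_, ?_, ?_⟩, ?_, ?_⟩
  · rw [nodeLaw, ae_map_iff (p := fun x => x.leafHeights.length = i + j) hm.aemeasurable
      (TimedTree.measurable_length_leafHeights (measurableSet_singleton (i + j)))]
    filter_upwards [hlen] with x hx
    rw [TimedTree.length_leafHeights_split, hx.1, hx.2]
  · rw [nodeLaw, integrable_map_measure (TimedTree.measurable_powerSum 1).aestronglyMeasurable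
      hm.aemeasurable]
    exact (j1.add j4).congr a1.symm
  · rw [nodeLaw, integrable_map_measure (TimedTree.measurable_powerSum 2).aestronglyMeasurable
      hm.aemeasurable]
    exact ((j2.add j3).add j5).congr a2.symm
  · rw [nodeLaw, integral_map hm.aemeasurable
      (TimedTree.measurable_powerSum 1).aestronglyMeasurable, integral_congr_ae a1,
      integral_add j1 j4, integral_const_mul, integral_fun_fst (fun t : ℝ => t), e1,
      integral_fun_snd (fun y : TimedTree × TimedTree => y.1.powerSum 1 + y.2.powerSum 1), eS1]
    simp
    ring
  · rw [nodeLaw, integral_map hm.aemeasurable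
      (TimedTree.measurable_powerSum 2).aestronglyMeasurable, integral_congr_ae a2,
      integral_add (by exact j2.add j3) j5, integral_add j2 j3, integral_const_mul, integral_const_mul,
      integral_fun_fst (fun t : ℝ => t ^ 2), e2,
      integral_prod_mul (fun t : ℝ => t)
        (fun y : TimedTree × TimedTree => y.1.powerSum 1 + y.2.powerSum 1), e1, eS1,
      integral_fun_snd (fun y : TimedTree × TimedTree => y.1.powerSum 2 + y.2.powerSum 2), eS2]
    simp
    ring

theorem mixture_moments {ι : Type*} [Fintype ι] {p : ι → ℝ} (hp : ∀ i, 0 ≤ p i)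
    (hp1 : ∑ i, p i = 1) {ν : ι → Measure TimedTree} {n : ℕ} (hν : ∀ i, IsRegular (ν i) n) :
    IsRegular (∑ i, ENNReal.ofReal (p i) • ν i) n ∧
    ∫ x, x.powerSum 1 ∂(∑ i, ENNReal.ofReal (p i) • ν i) = ∑ i, p i * ∫ x, x.powerSum 1 ∂(ν i) ∧
    ∫ x, x.powerSum 2 ∂(∑ i, ENNReal.ofReal (p i) • ν i)
      = ∑ i, p i * ∫ x, x.powerSum 2 ∂(ν i) := by
  have k1 : ∀ i ∈ Finset.univ, Integrable (TimedTree.powerSum 1) (ENNReal.ofReal (p i) • ν i) :=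
    fun i _ => (hν i).integrable_one.smul_measure ENNReal.ofReal_ne_top
  have k2 : ∀ i ∈ Finset.univ, Integrable (TimedTree.powerSum 2) (ENNReal.ofReal (p i) • ν i) :=
    fun i _ => (hν i).integrable_two.smul_measure ENNReal.ofReal_ne_top
  refine ⟨⟨⟨?_⟩, ?_, ?_, ?_⟩, ?_, ?_⟩
  · have : ∀ i, (ν i) Set.univ = 1 := fun i => (hν i).prob.measure_univ
    simp only [Measure.coe_finsetSum, Measure.coe_smul, Finset.sum_apply, Pi.smul_apply, this,
      smul_eq_mul, mul_one]
    rw [← ENNReal.ofReal_sum_of_nonneg fun i _ => hp i, hp1, ENNReal.ofReal_one]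
  · rw [ae_iff]
    simp only [Measure.coe_finsetSum, Measure.coe_smul, Finset.sum_apply, Pi.smul_apply]
    refine Finset.sum_eq_zero fun i _ => ?_
    rw [ae_iff.1 (hν i).length, smul_zero]
  · exact integrable_finsetSum_measure.2 k1
  · exact integrable_finsetSum_measure.2 k2
  · rw [integral_finsetSum_measure k1]
    refine Finset.sum_congr rfl fun i _ => ?_
    rw [integral_smul_measure, ENNReal.toReal_ofReal (hp i), smul_eq_mul]
  · rw [integral_finsetSum_measure k2]
    refine Finset.sum_congr rfl fun i _ => ?_
    rw [integral_smul_measure, ENNReal.toReal_ofReal (hp i), smul_eq_mul]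

theorem treeLaw_add_two (n : ℕ) :
    treeLaw (n + 2) = ∑ i : Fin (n + 1), ENNReal.ofReal (q (n + 2) (i.1 + 1)) •
      nodeLaw (h (n + 1)) (treeLaw (i.1 + 1)) (treeLaw (n + 1 - i.1)) := by
  rw [treeLaw]
  rfl

theorem sum_fin_eq_sum_Ico (n : ℕ) (X : ℕ → ℝ) :
    ∑ i : Fin (n + 1), X (i.1 + 1) = ∑ i ∈ Finset.Ico 1 (n + 2), X i := by
  rw [Fin.sum_univ_eq_sum_range (fun i => X (i + 1)), Finset.sum_Ico_eq_sum_range]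
  exact Finset.sum_congr rfl fun i _ => by rw [add_comm]

theorem isRegular_dirac_leaf : IsRegular (Measure.dirac TimedTree.leaf) 1 := by
  refine ⟨inferInstance, ?_, ?_, ?_⟩
  · rw [ae_dirac_iff (p := fun x : TimedTree => x.leafHeights.length = 1)
      (TimedTree.measurable_length_leafHeights (measurableSet_singleton 1))]
    rfl
  · exact (integrable_const ((TimedTree.leaf).powerSum 1)).congr
      (ae_eq_dirac' (TimedTree.measurable_powerSum 1)).symm
  · exact (integrable_const ((TimedTree.leaf).powerSum 2)).congr
      (ae_eq_dirac' (TimedTree.measurable_powerSum 2)).symm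

/-- The first-step recursion for the expected power sums. -/
theorem treeLaw_moments (n : ℕ)
    (ih : ∀ m, 1 ≤ m → m < n + 2 → IsRegular (treeLaw m) m) :
    IsRegular (treeLaw (n + 2)) (n + 2) ∧
    ∫ x, x.powerSum 1 ∂(treeLaw (n + 2)) = ∑ i ∈ Finset.Ico 1 (n + 2), q (n + 2) i *
      (((n + 2 : ℕ) : ℝ) / h (n + 1) +
        (∫ x, x.powerSum 1 ∂(treeLaw i) + ∫ x, x.powerSum 1 ∂(treeLaw (n + 2 - i)))) ∧
    ∫ x, x.powerSum 2 ∂(treeLaw (n + 2)) = ∑ i ∈ Finset.Ico 1 (n + 2), q (n + 2) i *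
      (2 * ((n + 2 : ℕ) : ℝ) / h (n + 1) ^ 2 +
        2 / h (n + 1) *
          (∫ x, x.powerSum 1 ∂(treeLaw i) + ∫ x, x.powerSum 1 ∂(treeLaw (n + 2 - i))) +
        (∫ x, x.powerSum 2 ∂(treeLaw i) + ∫ x, x.powerSum 2 ∂(treeLaw (n + 2 - i)))) := by
  have key : ∀ i : Fin (n + 1), _ := fun i =>
    nodeLaw_moments (h_pos (by omega : 1 ≤ n + 1))
      (ih (i.1 + 1) (by omega) (by omega)) (ih (n + 1 - i.1) (by omega) (by omega))
  have hsum : ∀ i : Fin (n + 1), i.1 + 1 + (n + 1 - i.1) = n + 2 := fun i => by omega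
  have hc : ∀ i : Fin (n + 1), ((i.1 + 1 : ℕ) : ℝ) + ((n + 1 - i.1 : ℕ) : ℝ) = ((n + 2 : ℕ) : ℝ) :=
    fun i => by rw [← hsum i]; push_cast; rfl
  have hq : ∀ i : Fin (n + 1), 0 ≤ q (n + 2) (i.1 + 1) :=
    fun i => q_nonneg (Finset.mem_Ico.2 ⟨by omega, by omega⟩)
  have hq1 : ∑ i : Fin (n + 1), q (n + 2) (i.1 + 1) = 1 := by
    rw [sum_fin_eq_sum_Ico n (q (n + 2)), sum_q (by omega)]
  obtain ⟨R, M1, M2⟩ := mixture_moments hq hq1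
    (ν := fun i => nodeLaw (h (n + 1)) (treeLaw (i.1 + 1)) (treeLaw (n + 1 - i.1))) (n := n + 2)
    fun i => hsum i ▸ (key i).1
  have hsub : ∀ i : Fin (n + 1), n + 2 - (i.1 + 1) = n + 1 - i.1 := fun i => by omega
  rw [treeLaw_add_two]
  refine ⟨R, ?_, ?_⟩
  · rw [M1, ← sum_fin_eq_sum_Ico]
    refine Finset.sum_congr rfl fun i _ => ?_
    rw [(key i).2.1, hc, hsub]
  · rw [M2, ← sum_fin_eq_sum_Ico]
    refine Finset.sum_congr rfl fun i _ => ?_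
    rw [(key i).2.2, hc, hsub]

theorem isRegular_treeLaw (n : ℕ) (hn : 1 ≤ n) : IsRegular (treeLaw n) n := by
  induction n using Nat.strong_induction_on with
  | _ n ih =>
    match n, hn with
    | 1, _ => rw [treeLaw]; exact isRegular_dirac_leaf
    | n + 2, _ => exact (treeLaw_moments n fun m h1 h2 => ih m h2 h1).1

/-- The mean over the leaves of the expected `p`-th power of the leaf height. -/
noncomputable def moment (p n : ℕ) : ℝ := (∫ x, x.powerSum p ∂(treeLaw n)) / n

theorem sum_q_mul_integral (p m : ℕ) :
    ∑ i ∈ Finset.Ico 1 m, q m i *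
      (∫ x, x.powerSum p ∂(treeLaw i) + ∫ x, x.powerSum p ∂(treeLaw (m - i)))
      = m / h (m - 1) * ∑ i ∈ Finset.Ico 1 m, moment p i / ((m : ℝ) - i) := by
  simp only [mul_add]
  rw [Finset.sum_add_distrib, sum_q_mul_reflect m fun i => ∫ x, x.powerSum p ∂(treeLaw i),
    ← Finset.sum_add_distrib, Finset.mul_sum]
  refine Finset.sum_congr rfl fun i hi => ?_
  have h1 := (cast_sub_pos hi).ne'
  have h2 := (cast_pos_of_mem hi).ne'
  have e : ∫ x, x.powerSum p ∂(treeLaw i) = i * moment p i := by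
    unfold moment; field_simp
  rw [e, ← mul_assoc, q_mul_cast hi]
  ring

/-- The generator of the chain of sizes of the intervals that contain a random leaf, up to sign:
from `n` it jumps to `i < n` at rate `1 / (n - i)`. -/
noncomputable def splitOp (f : ℕ → ℝ) (n : ℕ) : ℝ := ∑ i ∈ Finset.Ico 1 n, (f n - f i) / ((n : ℝ) - i)

theorem splitOp_eq (f : ℕ → ℝ) (n : ℕ) :
    splitOp f n = h (n - 1) * f n - ∑ i ∈ Finset.Ico 1 n, f i / ((n : ℝ) - i) := by
  simp only [splitOp, sub_div]
  rw [Finset.sum_sub_distrib, ← sum_one_div_sub, Finset.sum_mul]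
  congr 1
  exact Finset.sum_congr rfl fun i _ => by ring

theorem moment_at_one (p : ℕ) (hp : p ≠ 0) : moment p 1 = 0 := by
  rw [moment, treeLaw, integral_dirac' _ _ (TimedTree.measurable_powerSum p).stronglyMeasurable]
  simp [TimedTree.powerSum, TimedTree.leafHeights, hp]

theorem splitOp_moment_one {n : ℕ} (hn : 2 ≤ n) : splitOp (moment 1) n = 1 := by
  obtain ⟨n, rfl⟩ : ∃ k, n = k + 2 := ⟨n - 2, by omega⟩
  have hh : 0 < h (n + 1) := h_pos (by omega)
  have hE := (treeLaw_moments n fun m h1 _ => isRegular_treeLaw m h1).2.1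
  simp only [mul_add] at hE
  rw [Finset.sum_add_distrib, ← Finset.sum_mul, sum_q (by omega)] at hE
  simp only [← mul_add] at hE
  rw [sum_q_mul_integral 1 (n + 2)] at hE
  rw [splitOp_eq, moment, hE]
  simp only [show n + 2 - 1 = n + 1 from rfl]
  field_simp
  ring

theorem splitOp_moment_two {n : ℕ} (hn : 2 ≤ n) :
    splitOp (moment 2) n = 2 * moment 1 n := by
  have h1 := splitOp_moment_one hn
  rw [splitOp_eq] at h1
  obtain ⟨n, rfl⟩ : ∃ k, n = k + 2 := ⟨n - 2, by omega⟩
  have hh : 0 < h (n + 1) := h_pos (by omega)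
  have hE := (treeLaw_moments n fun m h1 _ => isRegular_treeLaw m h1).2.2
  have hs : ∀ X Y : ℕ → ℝ, ∀ c d : ℝ,
      ∑ i ∈ Finset.Ico 1 (n + 2), q (n + 2) i * (c + d * X i + Y i)
        = c + d * ∑ i ∈ Finset.Ico 1 (n + 2), q (n + 2) i * X i
          + ∑ i ∈ Finset.Ico 1 (n + 2), q (n + 2) i * Y i := by
    intro X Y c d
    simp only [mul_add, Finset.sum_add_distrib, ← Finset.sum_mul, sum_q hn, one_mul,
      Finset.mul_sum, mul_left_comm]
  rw [hs, sum_q_mul_integral 1 (n + 2), sum_q_mul_integral 2 (n + 2)] at hE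
  rw [splitOp_eq, show moment 2 (n + 2) = _ from congrArg (· / ((n + 2 : ℕ) : ℝ)) hE]
  simp only [show n + 2 - 1 = n + 1 from rfl] at h1 ⊢
  have e : ∑ i ∈ Finset.Ico 1 (n + 2), moment 1 i / (((n + 2 : ℕ) : ℝ) - i)
      = h (n + 1) * moment 1 (n + 2) - 1 := by linarith
  rw [e]
  field_simp
  ring

/-! ### The height of a random leaf -/

theorem D_measurable (n : ℕ) : Measurable (D n) :=
  measurable_from_prod_countable_left fun k => TimedTree.measurable_getD_leafHeights k.1

theorem isProbabilityMeasure_leafLaw {n : ℕ} (hn : 1 ≤ n) :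
    IsProbabilityMeasure (leafLaw n) := by
  have := (isRegular_treeLaw n hn).prob
  have : Nonempty (Fin n) := ⟨⟨0, hn⟩⟩
  unfold leafLaw
  infer_instance

theorem sq_getD_le_powerSum (x : TimedTree) (k : ℕ) :
    (x.leafHeights.getD k 0) ^ 2 ≤ x.powerSum 2 := by
  rw [TimedTree.powerSum_eq]
  by_cases hk : k < x.leafHeights.length
  · exact Finset.single_le_sum (f := fun k => (x.leafHeights.getD k 0) ^ 2)
      (fun i _ => sq_nonneg _) (Finset.mem_range.2 hk)
  · rw [List.getD_eq_default _ _ (by omega)]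
    simpa using Finset.sum_nonneg fun i _ => sq_nonneg (x.leafHeights.getD i 0)

/-- The moments of `D n` are averages over the leaves; the integrability hypothesis concerns every
index `k`, the default value being used for `k ≥ n`. -/
theorem integral_leafLaw {n : ℕ} (hn : 1 ≤ n) {p : ℕ}
    (hi : ∀ k : ℕ, Integrable (fun x : TimedTree => (x.leafHeights.getD k 0) ^ p) (treeLaw n)) :
    Integrable (fun x => D n x ^ p) (leafLaw n) ∧ ∫ x, D n x ^ p ∂(leafLaw n) = moment p n := by
  have := (isRegular_treeLaw n hn).prob
  have : Nonempty (Fin n) := ⟨⟨0, hn⟩⟩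
  have hI : Integrable (fun x => D n x ^ p) (leafLaw n) := by
    rw [leafLaw, integrable_prod_iff' ((D_measurable n).pow_const p).aestronglyMeasurable]
    exact ⟨ae_of_all _ fun k => hi k, Integrable.of_finite⟩
  refine ⟨hI, ?_⟩
  rw [leafLaw] at hI ⊢
  rw [integral_prod_symm _ hI, integral_fintype Integrable.of_finite, moment,
    integral_congr_ae (g := fun x : TimedTree =>
      ∑ k ∈ Finset.range n, (x.leafHeights.getD k 0) ^ p)
      ((isRegular_treeLaw n hn).length.mono fun x hx => by
        simp only [TimedTree.powerSum_eq, hx]),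
    integral_finsetSum _ fun k _ => hi k, Finset.sum_div, ← Fin.sum_univ_eq_sum_range
      (fun k => (∫ x : TimedTree, (x.leafHeights.getD k 0) ^ p ∂(treeLaw n)) / (n : ℝ))]
  refine Finset.sum_congr rfl fun k _ => ?_
  have e : (uniformOn (Set.univ : Set (Fin n))).real {k} = 1 / n := by
    simp [Measure.real, uniformOn_univ]
  rw [e]
  simp only [D, smul_eq_mul]
  ring

theorem memLp_D {n : ℕ} (hn : 1 ≤ n) : MemLp (D n) 2 (leafLaw n) ∧
    meanD n = moment 1 n ∧ varD n = moment 2 n - moment 1 n ^ 2 := by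
  have R := isRegular_treeLaw n hn
  have := R.prob
  have := isProbabilityMeasure_leafLaw hn
  have hm := TimedTree.measurable_getD_leafHeights
  have i2 : ∀ k : ℕ, Integrable (fun x : TimedTree => (x.leafHeights.getD k 0) ^ 2)
      (treeLaw n) := fun k =>
    R.integrable_two.mono' ((hm k).pow_const 2).aestronglyMeasurable
      (ae_of_all _ fun x => by
        rw [Real.norm_of_nonneg (sq_nonneg _)]
        exact sq_getD_le_powerSum x k)
  have i1 : ∀ k : ℕ, Integrable (fun x : TimedTree => (x.leafHeights.getD k 0) ^ 1)
      (treeLaw n) := fun k => by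
    simp only [pow_one]
    exact ((memLp_two_iff_integrable_sq (hm k).aestronglyMeasurable).2 (i2 k)).integrable
      one_le_two
  have hL := (memLp_two_iff_integrable_sq (D_measurable n).aestronglyMeasurable).2
    (integral_leafLaw hn i2).1
  have e1 : meanD n = moment 1 n := by
    simpa only [pow_one, meanD] using (integral_leafLaw hn i1).2
  refine ⟨hL, e1, ?_⟩
  rw [varD, variance_eq_sub hL, ← e1, ← (integral_leafLaw hn i2).2]
  rfl

theorem splitOp_congr {f g : ℕ → ℝ} {n : ℕ} (hfg : ∀ i, 1 ≤ i → f i = g i) (hn : 1 ≤ n) :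
    splitOp f n = splitOp g n :=
  Finset.sum_congr rfl fun i hi => by rw [hfg n hn, hfg i (Finset.mem_Ico.1 hi).1]

theorem splitOp_meanD {n : ℕ} (hn : 2 ≤ n) : splitOp meanD n = 1 := by
  rw [splitOp_congr (fun i hi => (memLp_D hi).2.1) (by omega), splitOp_moment_one hn]

theorem meanD_one : meanD 1 = 0 := by
  rw [(memLp_D le_rfl).2.1, moment_at_one 1 one_ne_zero]

theorem varD_one : varD 1 = 0 := by
  rw [(memLp_D le_rfl).2.2, moment_at_one 1 one_ne_zero, moment_at_one 2 two_ne_zero]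
  ring

/-- The law of total variance along the chain of sizes. -/
theorem splitOp_varD {n : ℕ} (hn : 2 ≤ n) :
    splitOp varD n = ∑ i ∈ Finset.Ico 1 n, (meanD n - meanD i) ^ 2 / ((n : ℝ) - i) := by
  have hv : ∀ i, 1 ≤ i → varD i = moment 2 i - meanD i ^ 2 := fun i hi => by
    rw [(memLp_D hi).2.2, (memLp_D hi).2.1]
  have h2 := splitOp_moment_two hn
  rw [← (memLp_D (by omega : 1 ≤ n)).2.1] at h2
  have h1 := splitOp_meanD hn
  rw [splitOp_congr hv (by omega)]
  have e : splitOp (fun i => moment 2 i - meanD i ^ 2) n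
      = splitOp (moment 2) n - 2 * meanD n * splitOp meanD n
        + ∑ i ∈ Finset.Ico 1 n, (meanD n - meanD i) ^ 2 / ((n : ℝ) - i) := by
    simp only [splitOp]
    rw [Finset.mul_sum, ← Finset.sum_sub_distrib, ← Finset.sum_add_distrib]
    exact Finset.sum_congr rfl fun i _ => by ring
  rw [e, h1, h2]
  ring

/-! ### The comparison principle -/

theorem splitOp_add (f g : ℕ → ℝ) (n : ℕ) :
    splitOp (fun i => f i + g i) n = splitOp f n + splitOp g n := by
  simp only [splitOp]
  rw [← Finset.sum_add_distrib]
  exact Finset.sum_congr rfl fun i _ => by ring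

theorem splitOp_sub (f g : ℕ → ℝ) (n : ℕ) :
    splitOp (fun i => f i - g i) n = splitOp f n - splitOp g n := by
  simp only [splitOp]
  rw [← Finset.sum_sub_distrib]
  exact Finset.sum_congr rfl fun i _ => by ring

theorem splitOp_const_mul (c : ℝ) (f : ℕ → ℝ) (n : ℕ) :
    splitOp (fun i => c * f i) n = c * splitOp f n := by
  simp only [splitOp]
  rw [Finset.mul_sum]
  exact Finset.sum_congr rfl fun i _ => by ring

theorem splitOp_const (c : ℝ) (n : ℕ) : splitOp (fun _ => c) n = 0 := by
  simp [splitOp]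

/-- The comparison principle: `splitOp f n` determines `f n` as a positive combination of itself
and of the earlier values of `f`. -/
theorem le_of_splitOp_le_splitOp {f g : ℕ → ℝ} (h1 : f 1 ≤ g 1)
    (hL : ∀ n, 2 ≤ n → splitOp f n ≤ splitOp g n) : ∀ n, 1 ≤ n → f n ≤ g n := by
  intro n
  induction n using Nat.strong_induction_on with
  | _ n ih =>
    intro hn
    rcases Nat.lt_or_ge n 2 with h2 | h2
    · obtain rfl : n = 1 := by omega
      exact h1
    · have hh : 0 < h (n - 1) := h_pos (by omega)
      have := hL n h2
      rw [splitOp_eq, splitOp_eq] at this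
      have hs : ∑ i ∈ Finset.Ico 1 n, f i / ((n : ℝ) - i)
          ≤ ∑ i ∈ Finset.Ico 1 n, g i / ((n : ℝ) - i) := by
        refine Finset.sum_le_sum fun i hi => ?_
        have hi' := Finset.mem_Ico.1 hi
        exact div_le_div_of_nonneg_right (ih i hi'.2 hi'.1) (cast_sub_pos hi).le
      exact le_of_mul_le_mul_left (by linarith) hh

theorem splitOp_inv {n : ℕ} (hn : 1 ≤ n) :
    splitOp (fun i => (i : ℝ)⁻¹) n = -(h (n - 1) / n) := by
  have hn' : (0 : ℝ) < n := by exact_mod_cast hn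
  rw [splitOp, ← sum_one_div, Finset.sum_div, ← Finset.sum_neg_distrib]
  refine Finset.sum_congr rfl fun i hi => ?_
  have h1 := (cast_sub_pos hi).ne'
  have h2 := (cast_pos_of_mem hi).ne'
  field_simp
  ring

/-- `-1 / √n` is a bounded strict supersolution. -/
theorem le_splitOp_neg_inv_sqrt {n : ℕ} (hn : 2 ≤ n) :
    1 / (4 * √(n : ℝ)) ≤ splitOp (fun i => -(1 / √(i : ℝ))) n := by
  have hn' : (2 : ℝ) ≤ n := by exact_mod_cast hn
  have hs : 0 < √(n : ℝ) := Real.sqrt_pos.2 (by linarith)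
  have hss : √(n : ℝ) * √(n : ℝ) = n := Real.mul_self_sqrt (by linarith)
  have key : ∀ i ∈ Finset.Ico 1 n, 1 / (2 * n * √(n : ℝ))
      ≤ (-(1 / √(n : ℝ)) - -(1 / √(i : ℝ))) / ((n : ℝ) - i) := by
    intro i hi
    have h1 := cast_sub_pos hi
    have h2 := cast_pos_of_mem hi
    have hi0 : 0 < √(i : ℝ) := Real.sqrt_pos.2 h2
    have hii : √(i : ℝ) * √(i : ℝ) = i := Real.mul_self_sqrt h2.le
    have hle : √(i : ℝ) ≤ √(n : ℝ) := Real.sqrt_le_sqrt (by linarith)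
    have e : (-(1 / √(n : ℝ)) - -(1 / √(i : ℝ))) / ((n : ℝ) - i)
        = 1 / (√(i : ℝ) * √(n : ℝ) * (√(n : ℝ) + √(i : ℝ))) := by
      rw [div_eq_div_iff h1.ne' (by positivity)]
      field_simp
      nlinarith
    rw [e]
    apply one_div_le_one_div_of_le (by positivity)
    calc √(i : ℝ) * √(n : ℝ) * (√(n : ℝ) + √(i : ℝ))
        ≤ √(n : ℝ) * √(n : ℝ) * (√(n : ℝ) + √(n : ℝ)) := by gcongr
      _ = 2 * n * √(n : ℝ) := by rw [hss]; ring
  calc 1 / (4 * √(n : ℝ)) ≤ ((n : ℝ) - 1) * (1 / (2 * n * √(n : ℝ))) := by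
        rw [mul_one_div, div_le_div_iff₀ (by positivity) (by positivity)]
        nlinarith
    _ = ∑ i ∈ Finset.Ico 1 n, 1 / (2 * n * √(n : ℝ)) := by
        rw [Finset.sum_const, Nat.card_Ico, nsmul_eq_mul, Nat.cast_sub (by omega), Nat.cast_one]
    _ ≤ _ := Finset.sum_le_sum key

/-- A bounded supersolution absorbs every error of order `1 / √n`, and `𝔼[D_n]` a constant one. -/
theorem le_of_splitOp_le {f : ℕ → ℝ} {C δ : ℝ} (hC : 0 ≤ C)
    (hL : ∀ n : ℕ, 2 ≤ n → splitOp f n ≤ C / √(n : ℝ) + δ) :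
    ∀ n, 1 ≤ n → f n ≤ f 1 + 4 * C + δ * meanD n := by
  intro n hn
  have := le_of_splitOp_le_splitOp (f := f)
    (g := fun n => (f 1 + 4 * C + 4 * C * -(1 / √(n : ℝ))) + δ * meanD n)
    (by simp [meanD_one])
    (fun n hn => by
      rw [splitOp_add, splitOp_add, splitOp_const, splitOp_const_mul, splitOp_const_mul,
        splitOp_meanD hn]
      have h1 := mul_le_mul_of_nonneg_left (le_splitOp_neg_inv_sqrt hn)
        (by positivity : 0 ≤ 4 * C)
      have h2 : 4 * C * (1 / (4 * √(n : ℝ))) = C / √(n : ℝ) := by ring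
      have := hL n hn
      linarith) n hn
  have h3 : 0 ≤ 4 * C * (1 / √(n : ℝ)) := by positivity
  linarith

theorem abs_le_of_abs_splitOp_le {f : ℕ → ℝ} {C : ℝ} (hC : 0 ≤ C)
    (hL : ∀ n : ℕ, 2 ≤ n → |splitOp f n| ≤ C / √(n : ℝ)) :
    ∀ n, 1 ≤ n → |f n| ≤ |f 1| + 4 * C := by
  intro n hn
  have h1 := le_of_splitOp_le (f := f) (δ := 0) hC
    (fun n hn => by rw [add_zero]; exact (le_abs_self _).trans (hL n hn)) n hn
  have h2 := le_of_splitOp_le (f := fun n => (-1) * f n) (δ := 0) hC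
    (fun n hn => by
      rw [add_zero, splitOp_const_mul, neg_one_mul]
      exact (neg_le_abs _).trans (hL n hn)) n hn
  rw [abs_le]
  constructor <;> linarith [le_abs_self (f 1), neg_le_abs (f 1)]

/-- The function `1 + log (n - 1)`, with value `0` at `1`, is a supersolution: every term of the
operator is at least `1 / (n - 1)`. -/
theorem meanD_le {n : ℕ} (hn : 2 ≤ n) : meanD n ≤ 1 + Real.log ((n : ℝ) - 1) := by
  have := le_of_splitOp_le_splitOp (f := meanD)
    (g := fun n => if n ≤ 1 then 0 else 1 + Real.log ((n : ℝ) - 1)) (by simp [meanD_one])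
    (fun n hn => by
      have hn' : (2 : ℝ) ≤ n := by exact_mod_cast hn
      rw [splitOp_meanD hn, splitOp]
      have hne : ¬ n ≤ 1 := by omega
      simp only [if_neg hne]
      calc (1 : ℝ) = ∑ i ∈ Finset.Ico 1 n, 1 / ((n : ℝ) - 1) := by
            rw [Finset.sum_const, Nat.card_Ico, nsmul_eq_mul, Nat.cast_sub (by omega),
              Nat.cast_one, mul_one_div, div_self (by linarith)]
        _ ≤ _ := by
            refine Finset.sum_le_sum fun i hi => ?_
            have h1 := cast_sub_pos hi
            by_cases hi1 : i ≤ 1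
            · obtain rfl : i = 1 := le_antisymm hi1 (Finset.mem_Ico.1 hi).1
              simp only [le_refl, if_true, Nat.cast_one, sub_zero]
              have := Real.log_nonneg (by linarith : (1 : ℝ) ≤ (n : ℝ) - 1)
              exact div_le_div_of_nonneg_right (by linarith) (by linarith)
            · have hi2 : (2 : ℝ) ≤ i := by exact_mod_cast (by omega : 2 ≤ i)
              rw [if_neg hi1, add_sub_add_left_eq_sub,
                ← Real.log_div (by linarith) (by linarith)]
              have := Real.one_sub_inv_le_log_of_pos
                (by apply div_pos <;> linarith : 0 < ((n : ℝ) - 1) / ((i : ℝ) - 1))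
              rw [inv_div] at this
              rw [div_le_div_iff₀ (by linarith) h1]
              have e : ((n : ℝ) - i) = (1 - ((i : ℝ) - 1) / ((n : ℝ) - 1)) * ((n : ℝ) - 1) := by
                have : (n : ℝ) - 1 ≠ 0 := by linarith
                field_simp
                ring
              rw [one_mul, e]
              gcongr
              linarith) n (by omega)
  simpa [show ¬ n ≤ 1 by omega] using this

/-! ### The operator on the logarithm -/

theorem hasSum_zeta {s : ℕ} (hs : 1 < s) :
    HasSum (fun k : ℕ => 1 / ((k : ℝ) + 1) ^ s) (zeta s) := by
  have hsum : Summable fun n : ℕ => 1 / (n : ℝ) ^ s := Real.summable_one_div_nat_pow.2 hs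
  have e : zeta s = ∑' n : ℕ, 1 / (n : ℝ) ^ s := by
    rw [zeta, zeta_nat_eq_tsum_of_gt_one hs, ← Complex.ofReal_re (∑' n : ℕ, 1 / (n : ℝ) ^ s)]
    push_cast
    rfl
  have h1 := (hasSum_nat_add_iff' 1).2 hsum.hasSum
  rw [← e] at h1
  have h0 : (0 : ℝ) ^ s = 0 := zero_pow (by omega)
  simpa [h0] using h1

theorem zeta_pos {s : ℕ} (hs : 1 < s) : 0 < zeta s := by
  refine (hasSum_zeta hs).tsum_eq ▸ (hasSum_zeta hs).summable.tsum_pos (fun k => by positivity) 0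
    (by positivity)

/-- The Riemann sum, without the endpoints, of `x ^ k` on `[0, 1]`. -/
noncomputable def powerMean (k n : ℕ) : ℝ := (∑ i ∈ Finset.Ico 1 n, ((i : ℝ) / n) ^ k) / n

theorem powerMean_eq (k n : ℕ) :
    powerMean k n = (∑ i ∈ Finset.Ico 1 n, (i : ℝ) ^ k) / (n : ℝ) ^ (k + 1) := by
  simp only [powerMean, div_pow]
  rw [← Finset.sum_div, div_div, pow_succ]

theorem powerMean_le {n : ℕ} (hn : 1 ≤ n) (k : ℕ) : powerMean k n ≤ 1 / ((k : ℝ) + 1) := by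
  have hn' : (0 : ℝ) < n := by exact_mod_cast hn
  have h1 := MonotoneOn.sum_le_integral_Ico (f := fun x : ℝ => x ^ k) hn
    (fun x hx y _ hxy => pow_le_pow_left₀ (by
      have := hx.1; simp only [Nat.cast_one] at this; linarith) hxy k)
  rw [integral_pow] at h1
  rw [powerMean_eq, div_le_div_iff₀ (by positivity) (by positivity), one_mul]
  rw [le_div_iff₀ (by positivity)] at h1
  refine h1.trans ?_
  simp

theorem le_powerMean {n : ℕ} (hn : 1 ≤ n) (k : ℕ) :
    1 / ((k : ℝ) + 1) - 1 / n ≤ powerMean k n := by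
  have hn' : (0 : ℝ) < n := by exact_mod_cast hn
  have h1 := MonotoneOn.integral_le_sum_Ico (f := fun x : ℝ => x ^ k) (Nat.zero_le n)
    (fun x hx y _ hxy => pow_le_pow_left₀ (by
      have := hx.1; simp only [Nat.cast_zero] at this; exact this) hxy k)
  rw [integral_pow] at h1
  have e : ∑ i ∈ Finset.Ico 0 n, (((i + 1 : ℕ)) : ℝ) ^ k
      = ∑ i ∈ Finset.Ico 1 n, (i : ℝ) ^ k + (n : ℝ) ^ k := by
    rw [Finset.sum_Ico_add' (fun i : ℕ => (i : ℝ) ^ k), ← Finset.sum_Ico_succ_top hn]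
  rw [e] at h1
  rw [powerMean_eq, le_div_iff₀ (by positivity), sub_mul]
  have e2 : 1 / (n : ℝ) * (n : ℝ) ^ (k + 1) = (n : ℝ) ^ k := by
    rw [pow_succ]
    field_simp
  rw [e2]
  simp only [Nat.cast_zero, ne_eq, Nat.add_eq_zero_iff, one_ne_zero, and_false,
    not_false_eq_true, zero_pow, sub_zero] at h1
  rw [div_mul_eq_mul_div, one_mul]
  linarith

theorem hasSum_log_sub_log {n i : ℕ} (hi : i ∈ Finset.Ico 1 n) :
    HasSum (fun k : ℕ => (((n : ℝ) - i) / n) ^ (k + 1) / ((k : ℝ) + 1))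
      (Real.log n - Real.log i) := by
  have h1 := cast_sub_pos hi
  have h2 := cast_pos_of_mem hi
  have hn : (0 : ℝ) < n := by linarith
  have hx : |((n : ℝ) - i) / n| < 1 := by
    rw [abs_of_pos (by positivity), div_lt_one hn]
    linarith
  have := Real.hasSum_pow_div_log_of_abs_lt_one hx
  have e : -Real.log (1 - ((n : ℝ) - i) / n) = Real.log n - Real.log i := by
    rw [sub_div, div_self hn.ne', sub_sub_cancel, Real.log_div h2.ne' hn.ne']
    ring
  rwa [e] at this

theorem sum_reflect_powerMean (n k : ℕ) :
    ∑ i ∈ Finset.Ico 1 n, (((n : ℝ) - i) / n) ^ k = ∑ i ∈ Finset.Ico 1 n, ((i : ℝ) / n) ^ k := by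
  rw [← sum_reflect n fun i => ((i : ℝ) / n) ^ k]
  exact Finset.sum_congr rfl fun i hi => by rw [Nat.cast_sub (Finset.mem_Ico.1 hi).2.le]

theorem hasSum_splitOp_log {n : ℕ} (hn : 1 ≤ n) :
    HasSum (fun k : ℕ => powerMean k n / ((k : ℝ) + 1)) (splitOp (fun i => Real.log i) n) := by
  have hn' : (0 : ℝ) < n := by exact_mod_cast hn
  have h1 := hasSum_sum (s := Finset.Ico 1 n) fun i hi =>
    (hasSum_log_sub_log hi).div_const ((n : ℝ) - i)
  convert! h1 using 1
  funext k
  rw [powerMean, ← sum_reflect_powerMean, Finset.sum_div, Finset.sum_div]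
  refine Finset.sum_congr rfl fun i hi => ?_
  have h2 := (cast_sub_pos hi).ne'
  rw [pow_succ]
  field_simp

/-- The coefficients in `hasSum_splitOp_log` are at most those of `ζ(2)`. -/
theorem splitOp_log_le {n : ℕ} (hn : 1 ≤ n) : splitOp (fun i => Real.log i) n ≤ zeta 2 := by
  refine hasSum_le (fun k => ?_) (hasSum_splitOp_log hn) (hasSum_zeta one_lt_two)
  rw [div_le_iff₀ (by positivity)]
  refine (powerMean_le hn k).trans (le_of_eq ?_)
  field_simp

theorem zeta_inv_mul_log_le {n : ℕ} (hn : 1 ≤ n) : (zeta 2)⁻¹ * Real.log n ≤ meanD n := by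
  refine le_of_splitOp_le_splitOp (f := fun n : ℕ => (zeta 2)⁻¹ * Real.log n) ?_ ?_ n hn
  · simp [meanD_one]
  · intro n hn
    rw [splitOp_const_mul, splitOp_meanD hn, inv_mul_le_one₀ (zeta_pos one_lt_two)]
    exact splitOp_log_le (by omega)

/-- Stirling's formula in logarithmic form. -/
theorem exists_stirling : ∃ C : ℝ, ∀ n : ℕ, 1 ≤ n →
    |Real.log n.factorial - (n * Real.log n - n + Real.log n / 2)| ≤ C := by
  have h1 : Tendsto (fun n => Real.log (Stirling.stirlingSeq n)) atTop
      (nhds (Real.log √Real.pi)) :=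
    Stirling.tendsto_stirlingSeq_sqrt_pi.log (by positivity)
  obtain ⟨C, hC⟩ := (Metric.isBounded_range_of_tendsto _ h1).exists_norm_le
  refine ⟨C + |Real.log 2 / 2|, fun n hn => ?_⟩
  have hn' : (0 : ℝ) < n := by exact_mod_cast hn
  have h2 := hC _ (Set.mem_range_self n)
  rw [Real.norm_eq_abs, Stirling.log_stirlingSeq_formula, Real.log_mul (by norm_num) hn'.ne',
    Real.log_div hn'.ne' (Real.exp_pos 1).ne', Real.log_exp] at h2
  calc _ = |(Real.log n.factorial - 1 / 2 * (Real.log 2 + Real.log n)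
          - n * (Real.log n - 1)) + Real.log 2 / 2| := by congr 1; ring
    _ ≤ _ := (abs_add_le _ _).trans (by gcongr)

theorem sum_log_sub_log (n : ℕ) :
    ∑ i ∈ Finset.Ico 1 n, (Real.log n - Real.log i) = n * Real.log n - Real.log n.factorial := by
  rcases Nat.eq_zero_or_pos n with rfl | hn
  · simp
  rw [Finset.sum_sub_distrib, Finset.sum_const, Nat.card_Ico, nsmul_eq_mul,
    Nat.cast_sub hn, ← Nat.mul_factorial_pred hn.ne', ← Finset.prod_Ico_id_eq_factorial]
  have hn' : (n : ℝ) ≠ 0 := by exact_mod_cast hn.ne'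
  have hp : (∏ x ∈ Finset.Ico 1 (n - 1 + 1), (x : ℝ)) ≠ 0 :=
    Finset.prod_ne_zero_iff.2 fun i hi => by
      have := (Finset.mem_Ico.1 hi).1; positivity
  push_cast
  rw [Real.log_mul hn' hp, Real.log_prod fun i hi => by
      have := (Finset.mem_Ico.1 hi).1; positivity, Nat.sub_add_cancel hn]
  ring

/-- With `x = 1 - i / n`, this is the expansion of `-(1 - x) log (1 - x) / x`. -/
theorem hasSum_mul_log_sub_log {n i : ℕ} (hi : i ∈ Finset.Ico 1 n) :
    HasSum (fun k : ℕ => (((n : ℝ) - i) / n) ^ (k + 1) / (((k : ℝ) + 1) * ((k : ℝ) + 2)))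
      (1 - i * (Real.log n - Real.log i) / ((n : ℝ) - i)) := by
  have h1 := cast_sub_pos hi
  have h2 := cast_pos_of_mem hi
  have hn : (0 : ℝ) < n := by linarith
  have hs := hasSum_log_sub_log hi
  have hs' := ((hasSum_nat_add_iff' 1).2 hs).div_const (((n : ℝ) - i) / n)
  have h3 := hs.sub hs'
  have hx : ((n : ℝ) - i) / n ≠ 0 := by positivity
  convert! h3 using 1
  · funext k
    push_cast
    rw [pow_succ _ (k + 1)]
    field_simp
    ring
  · simp
    field_simp
    ring

theorem hasSum_one_div_mul : HasSum (fun k : ℕ => 1 / (((k : ℝ) + 1) * ((k : ℝ) + 2))) 1 := by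
  rw [hasSum_iff_tendsto_nat_of_nonneg fun k => by positivity]
  have e : ∀ N : ℕ, ∑ k ∈ Finset.range N, 1 / (((k : ℝ) + 1) * ((k : ℝ) + 2))
      = 1 - 1 / ((N : ℝ) + 1) := by
    intro N
    induction N with
    | zero => simp
    | succ N ih =>
      rw [Finset.sum_range_succ, ih]
      push_cast
      field_simp
      ring
  simp only [e]
  simpa using tendsto_const_nhds.sub (tendsto_one_div_add_atTop_nhds_zero_nat (𝕜 := ℝ))

theorem hasSum_one_div_mul_sq :
    HasSum (fun k : ℕ => 1 / (((k : ℝ) + 1) * ((k : ℝ) + 2)) * (1 / ((k : ℝ) + 2)))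
      (2 - zeta 2) := by
  have h1 := (hasSum_nat_add_iff' 1).2 (hasSum_zeta one_lt_two)
  have h2 := hasSum_one_div_mul.sub h1
  convert! h2 using 1
  · funext k
    push_cast
    field_simp
    ring
  · simp
    ring

theorem abs_sum_mul_log_sub_log {n : ℕ} (hn : 1 ≤ n) :
    |(∑ i ∈ Finset.Ico 1 n, i * (Real.log n - Real.log i) / ((n : ℝ) - i)) / n - (zeta 2 - 1)|
      ≤ 1 / n := by
  have hn' : (0 : ℝ) < n := by exact_mod_cast hn
  have h1 := (hasSum_sum (s := Finset.Ico 1 n) fun i hi => hasSum_mul_log_sub_log hi).div_const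
    (n : ℝ)
  have h2 : HasSum (fun k : ℕ => 1 / (((k : ℝ) + 1) * ((k : ℝ) + 2)) * powerMean (k + 1) n)
      (1 - 1 / n -
        (∑ i ∈ Finset.Ico 1 n, i * (Real.log n - Real.log i) / ((n : ℝ) - i)) / n) := by
    convert! h1 using 1
    · funext k
      rw [← Finset.sum_div, sum_reflect_powerMean, powerMean]
      ring
    · rw [Finset.sum_sub_distrib, Finset.sum_const, Nat.card_Ico, nsmul_eq_mul, Nat.cast_sub hn]
      field_simp
      simp
  have up := hasSum_le (fun k => by
    have := powerMean_le hn (k + 1)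
    push_cast at this
    rw [add_assoc, one_add_one_eq_two] at this
    gcongr) h2 hasSum_one_div_mul_sq
  have lo := hasSum_le (fun k => by
    have := le_powerMean hn (k + 1)
    push_cast at this
    rw [add_assoc, one_add_one_eq_two] at this
    rw [← mul_sub]
    gcongr) (hasSum_one_div_mul_sq.sub (hasSum_one_div_mul.mul_right (1 / (n : ℝ)))) h2
  rw [abs_le]
  constructor <;> linarith [show 0 < 1 / (n : ℝ) by positivity]

/-- The first-order correction to `splitOp log n → ζ(2)`; the term `log n / (2 n)` comes from
Stirling's formula. -/
theorem exists_abs_splitOp_log_sub : ∃ C : ℝ, 0 ≤ C ∧ ∀ n : ℕ, 1 ≤ n →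
    |splitOp (fun i => Real.log i) n - (zeta 2 - Real.log n / (2 * n))| ≤ C / n := by
  obtain ⟨C, hC⟩ := exists_stirling
  have hC0 : 0 ≤ C := (abs_nonneg _).trans (hC 1 le_rfl)
  refine ⟨C + 1, by linarith, fun n hn => ?_⟩
  have hn' : (0 : ℝ) < n := by exact_mod_cast hn
  have e : splitOp (fun i => Real.log i) n
      = (n * Real.log n - Real.log n.factorial) / n
        + (∑ i ∈ Finset.Ico 1 n, i * (Real.log n - Real.log i) / ((n : ℝ) - i)) / n := by
    rw [← sum_log_sub_log, ← add_div, ← Finset.sum_add_distrib, splitOp, Finset.sum_div]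
    refine Finset.sum_congr rfl fun i hi => ?_
    have h1 := (cast_sub_pos hi).ne'
    field_simp
    ring
  have e2 : splitOp (fun i => Real.log i) n - (zeta 2 - Real.log n / (2 * n))
      = ((∑ i ∈ Finset.Ico 1 n, i * (Real.log n - Real.log i) / ((n : ℝ) - i)) / n
          - (zeta 2 - 1))
        - (Real.log n.factorial - (n * Real.log n - n + Real.log n / 2)) / n := by
    rw [e]
    field_simp
    ring
  rw [e2, add_comm C, add_div]
  refine (abs_sub _ _).trans (add_le_add (abs_sum_mul_log_sub_log hn) ?_)
  rw [abs_div, abs_of_pos hn']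
  gcongr
  exact hC n hn

/-! ### The Riemann sums of `log² y / (1 - y)` -/

theorem continuousOn_mul_log_sq : ContinuousOn (fun y : ℝ => y * Real.log y ^ 2) (Set.Ici 0) := by
  have h1 : Continuous fun y : ℝ => 4 * (√y * Real.log √y) ^ 2 :=
    ((Real.continuous_mul_log.comp Real.continuous_sqrt).pow 2).const_mul 4
  refine h1.continuousOn.congr fun y hy => ?_
  have hy' : (0 : ℝ) ≤ y := hy
  simp only
  rw [Real.log_sqrt hy', mul_pow, Real.sq_sqrt hy']
  ring

theorem integral_pow_mul_log_sq (k : ℕ) :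
    IntegrableOn (fun y : ℝ => y ^ k * Real.log y ^ 2) (Set.Ioo 0 1) ∧
      ∫ y in Set.Ioo (0 : ℝ) 1, y ^ k * Real.log y ^ 2 = 2 / ((k : ℝ) + 1) ^ 3 := by
  set H : ℝ → ℝ := fun y => y ^ k * ((y * Real.log y ^ 2) / ((k : ℝ) + 1)
    - 2 * (y * Real.log y) / ((k : ℝ) + 1) ^ 2 + 2 * y / ((k : ℝ) + 1) ^ 3) with hH
  -- `H` is an antiderivative, continuous up to `0`
  have hcont : ContinuousOn H (Set.Icc 0 1) := by
    have h1 := continuousOn_mul_log_sq.mono (Set.Icc_subset_Ici_self : Set.Icc (0 : ℝ) 1 ⊆ _)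
    have h2 := Real.continuous_mul_log.continuousOn (s := Set.Icc (0 : ℝ) 1)
    exact (continuousOn_pow k).mul (((h1.div_const _).sub ((h2.const_mul 2).div_const _)).add
      ((continuousOn_id.const_mul 2).div_const _))
  have hderiv : ∀ y ∈ Set.Ioo (0 : ℝ) 1, HasDerivAt H (y ^ k * Real.log y ^ 2) y := by
    intro y hy
    have hy0 : y ≠ 0 := hy.1.ne'
    have l1 := Real.hasDerivAt_log hy0
    have l2 := (hasDerivAt_id y).mul l1
    have l3 := (hasDerivAt_id y).mul (l1.pow 2)
    have := (hasDerivAt_pow k y).mul (((l3.div_const ((k : ℝ) + 1)).sub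
      ((l2.const_mul 2).div_const (((k : ℝ) + 1) ^ 2))).add
      (((hasDerivAt_id y).const_mul 2).div_const (((k : ℝ) + 1) ^ 3)))
    convert! this using 1
    rcases k with _ | k
    · simp
      field_simp
      ring
    · simp [pow_succ]
      field_simp
      ring
  have hint : IntervalIntegrable (fun y : ℝ => y ^ k * Real.log y ^ 2) volume 0 1 :=
    intervalIntegral.intervalIntegrable_deriv_of_nonneg (by simpa using hcont)
      (by simpa using hderiv) (by
        intro y hy
        have : 0 < y := by simpa using hy.1
        positivity)
  have hI := intervalIntegral.integral_eq_sub_of_hasDerivAt_of_le zero_le_one hcont hderiv hint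
  constructor
  · exact ((intervalIntegrable_iff_integrableOn_Ioo_of_le zero_le_one).1 hint)
  · rw [← integral_Ioc_eq_integral_Ioo, ← intervalIntegral.integral_of_le zero_le_one, hI]
    simp [hH]

/-- The function `log² y / (1 - y)`, whose integral over `[0, 1]` is `2 ζ(3)`. -/
noncomputable def logSqKernel (y : ℝ) : ℝ := Real.log y ^ 2 / (1 - y)

theorem integral_logSqKernel : ∫ y in Set.Ioo (0 : ℝ) 1, logSqKernel y = 2 * zeta 3 := by
  have hs := (hasSum_zeta (s := 3) (by norm_num)).mul_left 2
  have h1 := hasSum_integral_of_summable_integral_norm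
    (μ := volume.restrict (Set.Ioo (0 : ℝ) 1))
    (F := fun (k : ℕ) (y : ℝ) => y ^ k * Real.log y ^ 2)
    (fun k => (integral_pow_mul_log_sq k).1) (by
      refine hs.summable.congr fun k => ?_
      rw [mul_one_div, ← (integral_pow_mul_log_sq k).2]
      refine setIntegral_congr_fun measurableSet_Ioo fun y hy => ?_
      have : 0 < y := hy.1
      exact (Real.norm_of_nonneg (by positivity)).symm)
  have h2 : ∫ y in Set.Ioo (0 : ℝ) 1, logSqKernel y
      = ∫ y in Set.Ioo (0 : ℝ) 1, ∑' k : ℕ, y ^ k * Real.log y ^ 2 := by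
    refine setIntegral_congr_fun measurableSet_Ioo fun y hy => ?_
    rw [tsum_mul_right, tsum_geometric_of_lt_one hy.1.le hy.2, logSqKernel]
    ring
  rw [h2]
  refine h1.unique ?_
  convert! hs using 1
  funext k
  rw [(integral_pow_mul_log_sq k).2, mul_one_div]

theorem intervalIntegrable_logSqKernel : IntervalIntegrable logSqKernel volume 0 1 := by
  rw [intervalIntegrable_iff_integrableOn_Ioo_of_le zero_le_one]
  refine .of_integral_ne_zero ?_
  rw [integral_logSqKernel]
  have := zeta_pos (s := 3) (by norm_num)
  positivity

theorem antitoneOn_logSqKernel : AntitoneOn logSqKernel (Set.Ioc 0 1) := by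
  intro x hx y hy hxy
  rcases eq_or_lt_of_le hy.2 with rfl | hy1
  · have := hx.2
    simp only [logSqKernel, Real.log_one, sub_self, div_zero]
    exact div_nonneg (sq_nonneg _) (by linarith)
  have hx1 : x < 1 := hxy.trans_lt hy1
  have hsec := (strictConcaveOn_log_Ioi.concaveOn.neg).secant_mono (a := 1) (x := x) (y := y)
    (by simp) hx.1 hy.1 hx1.ne hy1.ne hxy
  have e : ∀ z : ℝ, ((-Real.log) z - (-Real.log) 1) / (z - 1) = Real.log z / (1 - z) := by
    intro z
    simp only [Pi.neg_apply, Real.log_one, neg_zero, sub_zero]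
    rw [← neg_sub 1 z, neg_div_neg_eq]
  rw [e, e] at hsec
  have hlog := Real.log_le_log hx.1 hxy
  have hly : Real.log y ≤ 0 := Real.log_nonpos hy.1.le hy1.le
  have hly' : Real.log y / (1 - y) ≤ 0 := div_nonpos_of_nonpos_of_nonneg hly (by linarith)
  calc logSqKernel y = (-Real.log y) * -(Real.log y / (1 - y)) := by rw [logSqKernel]; ring
    _ ≤ (-Real.log x) * -(Real.log x / (1 - x)) :=
        mul_le_mul (by linarith) (by linarith) (by linarith) (by linarith)
    _ = logSqKernel x := by rw [logSqKernel]; ring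

theorem logSqKernel_nonneg {y : ℝ} (hy : y ≤ 1) : 0 ≤ logSqKernel y :=
  div_nonneg (sq_nonneg _) (by linarith)

theorem logSqKernel_le {y : ℝ} (h0 : 0 < y) (h1 : y ≤ 1 / 2) :
    logSqKernel y ≤ 32 * y ^ (-(1 / 2) : ℝ) := by
  have hb := Real.abs_log_mul_self_rpow_lt y (1 / 4) h0 (by linarith) (by norm_num)
  have hsq : (Real.log y * y ^ (1 / 4 : ℝ)) ^ 2 ≤ 16 := by
    rw [← sq_abs]
    have := abs_nonneg (Real.log y * y ^ (1 / 4 : ℝ))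
    nlinarith
  have e : (y ^ (1 / 4 : ℝ)) ^ 2 = y ^ (1 / 2 : ℝ) := by
    rw [← Real.rpow_natCast, ← Real.rpow_mul h0.le]
    norm_num
  rw [mul_pow, e] at hsq
  have hp : 0 < y ^ (1 / 2 : ℝ) := Real.rpow_pos_of_pos h0 _
  rw [Real.rpow_neg h0.le, logSqKernel, ← div_eq_mul_inv, div_le_div_iff₀ (by linarith) hp]
  linarith

theorem integral_logSqKernel_le {n : ℕ} (hn : 2 ≤ n) :
    ∫ y in (0 : ℝ)..(1 / n), logSqKernel y ≤ 64 / √(n : ℝ) := by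
  have hn' : (2 : ℝ) ≤ n := by exact_mod_cast hn
  have h2 : 1 / (n : ℝ) ≤ 1 / 2 := one_div_le_one_div_of_le (by norm_num) hn'
  have h0 : 0 < 1 / (n : ℝ) := by positivity
  have hint := intervalIntegrable_logSqKernel.mono_set (c := 0) (d := 1 / (n : ℝ)) (by
    rw [Set.uIcc_of_le zero_le_one, Set.uIcc_of_le h0.le]
    exact Set.Icc_subset_Icc le_rfl (by linarith))
  have hr : IntervalIntegrable (fun y : ℝ => y ^ (-(1 / 2) : ℝ)) volume 0 (1 / n) :=
    intervalIntegral.intervalIntegrable_rpow' (by norm_num)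
  have h3 := intervalIntegral.integral_mono_on_of_le_Ioo h0.le hint (hr.const_mul 32)
    (fun y hy => logSqKernel_le hy.1 (hy.2.le.trans h2))
  refine h3.trans (le_of_eq ?_)
  rw [intervalIntegral.integral_const_mul, integral_rpow (Or.inl (by norm_num))]
  rw [Real.sqrt_eq_rpow, Real.div_rpow zero_le_one (by positivity)]
  norm_num
  ring

/-- The sum `∑ (log n - log i)² / (n - i)`, a Riemann sum of `logSqKernel` on the grid `i / n`. -/
noncomputable def logSqSum (n : ℕ) : ℝ :=
  ∑ i ∈ Finset.Ico 1 n, (Real.log n - Real.log i) ^ 2 / ((n : ℝ) - i)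

/-- `logSqKernel` is antitone, so that its Riemann sums differ from the integral by at most the
integral over the first cell and the first value. -/
theorem abs_logSqSum_sub {n : ℕ} (hn : 2 ≤ n) :
    |logSqSum n - 2 * zeta 3| ≤ 96 / √(n : ℝ) := by
  have hn' : (2 : ℝ) ≤ n := by exact_mod_cast hn
  have hn0 : (0 : ℝ) < n := by linarith
  have h2 : 1 / (n : ℝ) ≤ 1 / 2 := one_div_le_one_div_of_le (by norm_num) hn'
  have h0 : 0 < 1 / (n : ℝ) := by positivity
  have hanti : AntitoneOn (fun x : ℝ => logSqKernel (x / n)) (Set.Icc ((1 : ℕ) : ℝ) n) := by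
    intro x hx y hy hxy
    have hx1 := hx.1
    have hy1 := hy.1
    simp only [Nat.cast_one] at hx1 hy1
    exact antitoneOn_logSqKernel ⟨by positivity, (div_le_one hn0).2 hx.2⟩
      ⟨by positivity, (div_le_one hn0).2 hy.2⟩ (by gcongr)
  have lo := hanti.integral_le_sum_Ico (by omega : 1 ≤ n)
  have up := hanti.sum_le_integral_Ico (by omega : 1 ≤ n)
  have hsum : ∑ i ∈ Finset.Ico 1 n, logSqKernel ((i : ℝ) / n) = n * logSqSum n := by
    rw [logSqSum, Finset.mul_sum]
    refine Finset.sum_congr rfl fun i hi => ?_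
    have h3 := cast_sub_pos hi
    have h4 := cast_pos_of_mem hi
    have h5 : 1 - (i : ℝ) / n ≠ 0 := by
      rw [← div_self hn0.ne', ← sub_div]; positivity
    rw [logSqKernel, Real.log_div h4.ne' hn0.ne']
    field_simp
    ring
  have hshift : ∑ i ∈ Finset.Ico 1 n, logSqKernel (((i + 1 : ℕ) : ℝ) / n)
      = n * logSqSum n - logSqKernel (1 / n) := by
    have h3 := Finset.sum_Ico_add' (fun i : ℕ => logSqKernel ((i : ℝ) / n)) 1 n 1
    have h4 := Finset.sum_eq_sum_Ico_succ_bot (by omega : 1 < n + 1)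
      (fun i : ℕ => logSqKernel ((i : ℝ) / n))
    have h5 := Finset.sum_Ico_succ_top (by omega : 1 ≤ n)
      (fun i : ℕ => logSqKernel ((i : ℝ) / n))
    -- at the right endpoint the quotient is `0 / 0 = 0`, which is also the limit
    have h6 : logSqKernel ((n : ℝ) / n) = 0 := by simp [logSqKernel, div_self hn0.ne']
    rw [h5, h6, hsum] at h4
    rw [h3]
    simp only [Nat.cast_one] at h4
    linarith
  have hcv : ∫ x in ((1 : ℕ) : ℝ)..n, logSqKernel (x / n)
      = n * ∫ y in (1 / n : ℝ)..1, logSqKernel y := by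
    rw [intervalIntegral.integral_comp_div _ hn0.ne', div_self hn0.ne', smul_eq_mul, Nat.cast_one]
  have hsplit := intervalIntegral.integral_add_adjacent_intervals
    (intervalIntegrable_logSqKernel.mono_set (c := 0) (d := 1 / (n : ℝ)) (by
      rw [Set.uIcc_of_le zero_le_one, Set.uIcc_of_le h0.le]
      exact Set.Icc_subset_Icc le_rfl (by linarith)))
    (intervalIntegrable_logSqKernel.mono_set (c := 1 / (n : ℝ)) (d := 1) (by
      rw [Set.uIcc_of_le zero_le_one, Set.uIcc_of_le (by linarith)]
      exact Set.Icc_subset_Icc h0.le le_rfl))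
  rw [intervalIntegral.integral_of_le zero_le_one, integral_Ioc_eq_integral_Ioo,
    integral_logSqKernel] at hsplit
  rw [hcv, hsum] at lo
  rw [hcv, hshift] at up
  have lo' := le_of_mul_le_mul_left lo hn0
  have hsmall := integral_logSqKernel_le hn
  have hpos : 0 ≤ ∫ y in (0 : ℝ)..(1 / n), logSqKernel y :=
    intervalIntegral.integral_nonneg h0.le fun y hy => logSqKernel_nonneg (by linarith [hy.2])
  have hk : logSqKernel (1 / n) ≤ 32 * √(n : ℝ) := by
    refine (logSqKernel_le h0 h2).trans (le_of_eq ?_)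
    rw [Real.rpow_neg h0.le, ← Real.sqrt_eq_rpow, Real.sqrt_div zero_le_one, Real.sqrt_one,
      one_div, inv_inv]
  have hs : 0 < √(n : ℝ) := Real.sqrt_pos.2 hn0
  have hss : √(n : ℝ) * √(n : ℝ) = n := Real.mul_self_sqrt hn0.le
  have up' : logSqSum n ≤ (∫ y in (1 / n : ℝ)..1, logSqKernel y) + 32 / √(n : ℝ) := by
    refine le_of_mul_le_mul_left ?_ hn0
    have e : (n : ℝ) * (32 / √(n : ℝ)) = 32 * √(n : ℝ) := by
      rw [mul_div_assoc', div_eq_iff hs.ne', mul_assoc 32, hss]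
      ring
    rw [mul_add, e]
    linarith
  have e96 : 96 / √(n : ℝ) = 64 / √(n : ℝ) + 32 / √(n : ℝ) := by ring
  have : 0 < 32 / √(n : ℝ) := by positivity
  rw [abs_le, e96]
  constructor <;> linarith

/-! ### The mean up to a bounded error -/

theorem log_le_two_mul_sqrt {n : ℕ} (hn : 1 ≤ n) : Real.log n ≤ 2 * √(n : ℝ) := by
  have hn' : (0 : ℝ) < n := by exact_mod_cast hn
  have h1 := Real.log_le_sub_one_of_pos (Real.sqrt_pos.2 hn')
  rw [Real.log_sqrt hn'.le] at h1
  linarith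

theorem one_div_le_one_div_sqrt {n : ℕ} (hn : 1 ≤ n) : 1 / (n : ℝ) ≤ 1 / √(n : ℝ) := by
  have hn' : (1 : ℝ) ≤ n := by exact_mod_cast hn
  exact one_div_le_one_div_of_le (Real.sqrt_pos.2 (by linarith))
    (Real.sqrt_le_self_iff.2 (Or.inr hn'))

theorem exists_abs_zeta_sub_splitOp_log : ∃ C : ℝ, 0 ≤ C ∧ ∀ n : ℕ, 1 ≤ n →
    |zeta 2 - splitOp (fun i => Real.log i) n| ≤ C / √(n : ℝ) := by
  obtain ⟨C, hC0, hC⟩ := exists_abs_splitOp_log_sub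
  refine ⟨C + 1, by linarith, fun n hn => ?_⟩
  have hn' : (1 : ℝ) ≤ n := by exact_mod_cast hn
  have hs : 0 < √(n : ℝ) := Real.sqrt_pos.2 (by linarith)
  have hss : √(n : ℝ) * √(n : ℝ) = n := Real.mul_self_sqrt (by linarith)
  have h1 : Real.log n / (2 * n) ≤ 1 / √(n : ℝ) := by
    rw [div_le_div_iff₀ (by positivity) hs]
    have := mul_le_mul_of_nonneg_right (log_le_two_mul_sqrt hn) hs.le
    rw [mul_assoc, hss] at this
    linarith
  have h2 : 0 ≤ Real.log n / (2 * n) := by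
    have := Real.log_nonneg hn'
    positivity
  have h3 := mul_le_mul_of_nonneg_left (one_div_le_one_div_sqrt hn) hC0
  rw [mul_one_div, mul_one_div] at h3
  have h4 := abs_le.1 (hC n hn)
  rw [add_div, abs_le]
  constructor <;> linarith [h4.1, h4.2]

/-- The deviation of the mean from its leading term. -/
noncomputable def deviation (n : ℕ) : ℝ := meanD n - (zeta 2)⁻¹ * Real.log n

theorem deviation_one : deviation 1 = 0 := by simp [deviation, meanD_one]

theorem splitOp_deviation {n : ℕ} (hn : 2 ≤ n) :
    splitOp deviation n = (zeta 2)⁻¹ * (zeta 2 - splitOp (fun i => Real.log i) n) := by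
  have hz := (zeta_pos one_lt_two).ne'
  have : splitOp deviation n
      = splitOp meanD n - splitOp (fun n : ℕ => (zeta 2)⁻¹ * Real.log n) n := splitOp_sub _ _ n
  rw [this, splitOp_const_mul, splitOp_meanD hn, mul_sub, inv_mul_cancel₀ hz]

theorem exists_abs_splitOp_deviation_le : ∃ C : ℝ, 0 ≤ C ∧ ∀ n : ℕ, 2 ≤ n →
    |splitOp deviation n| ≤ C / √(n : ℝ) := by
  obtain ⟨C, hC0, hC⟩ := exists_abs_zeta_sub_splitOp_log
  have hz := zeta_pos one_lt_two
  refine ⟨(zeta 2)⁻¹ * C, by positivity, fun n hn => ?_⟩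
  rw [splitOp_deviation hn, abs_mul, abs_of_pos (by positivity : 0 < (zeta 2)⁻¹), mul_div_assoc]
  exact mul_le_mul_of_nonneg_left (hC n (by omega)) (by positivity)

theorem exists_abs_deviation_le : ∃ K : ℝ, 0 ≤ K ∧ ∀ n : ℕ, 1 ≤ n → |deviation n| ≤ K := by
  obtain ⟨C, hC0, hC⟩ := exists_abs_splitOp_deviation_le
  refine ⟨4 * C, by positivity, fun n hn => ?_⟩
  have := abs_le_of_abs_splitOp_le hC0 hC n hn
  rwa [deviation_one, abs_zero, zero_add] at this

/-! ### The variance -/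

/-- The constant `2 ζ(3) / ζ(2) ^ 3`. -/
noncomputable def varConst : ℝ := 2 * zeta 3 / zeta 2 ^ 3

/-- The contribution of the deviation of the mean to `splitOp varD n`. -/
noncomputable def crossSum (n : ℕ) : ℝ :=
  ∑ i ∈ Finset.Ico 1 n, (2 * (zeta 2)⁻¹ * (Real.log n - Real.log i) * (deviation n - deviation i)
    + (deviation n - deviation i) ^ 2) / ((n : ℝ) - i)

/-- With `meanD = (zeta 2)⁻¹ * log + deviation`, the squares in `splitOp_varD` are expanded. -/
theorem splitOp_varD_sub {n : ℕ} (hn : 2 ≤ n) :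
    splitOp (fun i => varD i - varConst * Real.log i) n
      = (zeta 2)⁻¹ ^ 2 * (logSqSum n - 2 * zeta 3)
        + varConst * (zeta 2 - splitOp (fun i => Real.log i) n) + crossSum n := by
  have hz := (zeta_pos one_lt_two).ne'
  have e : ∑ i ∈ Finset.Ico 1 n, (meanD n - meanD i) ^ 2 / ((n : ℝ) - i)
      = (zeta 2)⁻¹ ^ 2 * logSqSum n + crossSum n := by
    rw [logSqSum, crossSum, Finset.mul_sum, ← Finset.sum_add_distrib]
    refine Finset.sum_congr rfl fun i _ => ?_
    simp only [deviation]
    ring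
  have hc : varConst * zeta 2 = (zeta 2)⁻¹ ^ 2 * (2 * zeta 3) := by
    unfold varConst
    field_simp
  rw [splitOp_sub, splitOp_const_mul, splitOp_varD hn, e, mul_sub, mul_sub, hc]
  ring

/-- The part of `splitOp varD n` that does not come from the deviation of the mean. -/
theorem exists_abs_main_le : ∃ C : ℝ, 0 ≤ C ∧ ∀ n : ℕ, 2 ≤ n →
    |(zeta 2)⁻¹ ^ 2 * (logSqSum n - 2 * zeta 3)
        + varConst * (zeta 2 - splitOp (fun i => Real.log i) n)| ≤ C / √(n : ℝ) := by
  obtain ⟨C, hC0, hC⟩ := exists_abs_zeta_sub_splitOp_log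
  refine ⟨(zeta 2)⁻¹ ^ 2 * 96 + |varConst| * C, by positivity, fun n hn => ?_⟩
  refine (abs_add_le _ _).trans ?_
  rw [abs_mul, abs_mul, abs_of_nonneg (sq_nonneg (zeta 2)⁻¹), add_div, mul_div_assoc,
    mul_div_assoc]
  gcongr
  · exact abs_logSqSum_sub hn
  · exact hC n (by omega)

/-- The quadratic error is itself, up to a small term, the image under `splitOp` of a bounded
function. -/
theorem sum_sq_sub_eq (f : ℕ → ℝ) (n : ℕ) :
    ∑ i ∈ Finset.Ico 1 n, (f n - f i) ^ 2 / ((n : ℝ) - i)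
      = 2 * f n * splitOp f n - splitOp (fun i => f i ^ 2) n := by
  simp only [splitOp]
  rw [Finset.mul_sum, ← Finset.sum_sub_distrib]
  exact Finset.sum_congr rfl fun i _ => by ring

/-- The elementary inequality `2 a x y ≤ ε x² + (a² / ε) y²`, applied to each term. -/
theorem abs_crossSum_le {ε : ℝ} (hε : 0 < ε) (n : ℕ) :
    |crossSum n| ≤ ε * logSqSum n + (1 + (zeta 2)⁻¹ ^ 2 / ε) *
      ∑ i ∈ Finset.Ico 1 n, (deviation n - deviation i) ^ 2 / ((n : ℝ) - i) := by
  rw [crossSum, logSqSum, Finset.mul_sum, Finset.mul_sum, ← Finset.sum_add_distrib]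
  refine (Finset.abs_sum_le_sum_abs _ _).trans (Finset.sum_le_sum fun i hi => ?_)
  have h1 := cast_sub_pos hi
  rw [abs_div, abs_of_pos h1, mul_div_assoc', mul_div_assoc', ← add_div]
  apply div_le_div_of_nonneg_right _ h1.le
  set x := Real.log n - Real.log i
  set y := deviation n - deviation i
  set a := (zeta 2)⁻¹
  have e1 : ε * x ^ 2 + a ^ 2 / ε * y ^ 2 - 2 * a * x * y = (ε * x - a * y) ^ 2 / ε := by
    field_simp
    ring
  have e2 : ε * x ^ 2 + a ^ 2 / ε * y ^ 2 + 2 * a * x * y = (ε * x + a * y) ^ 2 / ε := by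
    field_simp
    ring
  have p1 : 0 ≤ (ε * x - a * y) ^ 2 / ε := by positivity
  have p2 : 0 ≤ (ε * x + a * y) ^ 2 / ε := by positivity
  rw [abs_le]
  constructor <;> nlinarith [sq_nonneg y]

/-- By `sum_sq_sub_eq`, the function `varD - varConst * log` becomes a subsolution of an equation
with right-hand side `O(1 / √n) + ε` once a multiple of `deviation ^ 2`, which is bounded, is added
to it; the same holds for its opposite. -/
theorem exists_abs_varD_sub_le {ε : ℝ} (hε : 0 < ε) : ∃ C : ℝ, ∀ n : ℕ, 1 ≤ n →
    |varD n - varConst * Real.log n| ≤ C + ε * meanD n := by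
  obtain ⟨A, hA0, hA⟩ := exists_abs_main_le
  obtain ⟨B, hB0, hB⟩ := exists_abs_splitOp_deviation_le
  obtain ⟨K, hK0, hK⟩ := exists_abs_deviation_le
  have hz3 : 0 < zeta 3 := zeta_pos (by norm_num)
  have hδ : 0 < ε / (2 * zeta 3) := by positivity
  set δ := ε / (2 * zeta 3) with hδ_def
  set M := 1 + (zeta 2)⁻¹ ^ 2 / δ
  have hM : 0 ≤ M := by positivity
  set C := A + δ * 96 + M * (2 * K * B) with hC_def
  have hC : 0 ≤ C := by positivity
  -- `σ = ±1` gives the upper and the lower bound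
  have key : ∀ σ : ℝ, |σ| = 1 → ∀ n : ℕ, 2 ≤ n →
      splitOp (fun i => σ * (varD i - varConst * Real.log i) + M * deviation i ^ 2) n
        ≤ C / √(n : ℝ) + ε := by
    intro σ hσ n hn
    rw [splitOp_add, splitOp_const_mul, splitOp_const_mul, splitOp_varD_sub hn]
    have h1 := abs_crossSum_le hδ n
    rw [sum_sq_sub_eq] at h1
    have h2 := (abs_le.1 (abs_logSqSum_sub hn)).2
    have h3 : 2 * deviation n * splitOp deviation n ≤ 2 * K * B / √(n : ℝ) := by
      calc _ ≤ |2 * deviation n * splitOp deviation n| := le_abs_self _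
        _ = 2 * |deviation n| * |splitOp deviation n| := by
            rw [abs_mul, abs_mul, abs_of_pos (two_pos : (0 : ℝ) < 2)]
        _ ≤ 2 * K * (B / √(n : ℝ)) := by
            gcongr
            · exact hK n (by omega)
            · exact hB n hn
        _ = _ := by ring
    have h4 : ∀ x : ℝ, σ * x ≤ |x| := fun x => by
      rw [← one_mul |x|, ← hσ, ← abs_mul]
      exact le_abs_self _
    have h5 := h4 ((zeta 2)⁻¹ ^ 2 * (logSqSum n - 2 * zeta 3)
      + varConst * (zeta 2 - splitOp (fun i => Real.log i) n) + crossSum n)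
    have h6 := abs_add_le ((zeta 2)⁻¹ ^ 2 * (logSqSum n - 2 * zeta 3)
      + varConst * (zeta 2 - splitOp (fun i => Real.log i) n)) (crossSum n)
    have h7 := hA n hn
    have h8 := mul_le_mul_of_nonneg_left h2 hδ.le
    have h9 := mul_le_mul_of_nonneg_left h3 hM
    have h10 : δ * (2 * zeta 3) = ε := by rw [hδ_def]; field_simp
    have h11 : C / √(n : ℝ) = A / √(n : ℝ) + δ * (96 / √(n : ℝ)) + M * (2 * K * B / √(n : ℝ)) := by
      rw [hC_def]; ring
    rw [h11]
    have h12 : δ * (logSqSum n - 2 * zeta 3) = δ * logSqSum n - ε := by rw [mul_sub, h10]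
    linarith
  refine ⟨4 * C, fun n hn => ?_⟩
  have up := le_of_splitOp_le hC (key 1 (by simp)) n hn
  have lo := le_of_splitOp_le hC (key (-1) (by simp)) n hn
  simp only [varD_one, deviation_one, Nat.cast_one, Real.log_one] at up lo
  have : 0 ≤ M * deviation n ^ 2 := by positivity
  rw [abs_le]
  constructor <;> linarith

/-! ### Consequences of an expansion of the mean -/

theorem log_sub_log_le {n i : ℕ} (hi : i ∈ Finset.Ico 1 n) :
    Real.log n - Real.log i ≤ ((n : ℝ) - i) / (√(i : ℝ) * √(n : ℝ)) := by
  have h1 := cast_sub_pos hi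
  have h2 := cast_pos_of_mem hi
  have hn : (0 : ℝ) < n := by linarith
  have s1 : 0 < √(i : ℝ) := Real.sqrt_pos.2 h2
  have s2 : 0 < √(n : ℝ) := Real.sqrt_pos.2 hn
  have q1 : √(i : ℝ) * √(i : ℝ) = i := Real.mul_self_sqrt h2.le
  have q2 : √(n : ℝ) * √(n : ℝ) = n := Real.mul_self_sqrt hn.le
  have hle : √(i : ℝ) ≤ √(n : ℝ) := Real.sqrt_le_sqrt (by linarith)
  have h3 : 0 ≤ Real.log (√(n : ℝ) / √(i : ℝ)) := Real.log_nonneg ((one_le_div s1).2 hle)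
  -- with `x = √(n / i)`, this is `2 log x ≤ x - x⁻¹`
  have h4 := Real.self_le_sinh_iff.2 h3
  rw [Real.sinh_log (by positivity), Real.log_div s2.ne' s1.ne', Real.log_sqrt hn.le,
    Real.log_sqrt h2.le] at h4
  have e : ((n : ℝ) - i) / (√(i : ℝ) * √(n : ℝ))
      = √(n : ℝ) / √(i : ℝ) - (√(n : ℝ) / √(i : ℝ))⁻¹ := by
    rw [inv_div, div_sub_div _ _ s1.ne' s2.ne', q1, q2]
  rw [e]
  linarith

theorem exists_sum_one_div_mul_sqrt_le : ∃ Z : ℝ, 0 ≤ Z ∧ ∀ n : ℕ,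
    ∑ i ∈ Finset.Ico 1 n, 1 / ((i : ℝ) * √(i : ℝ)) ≤ Z := by
  have hs : Summable fun i : ℕ => 1 / (i : ℝ) ^ (3 / 2 : ℝ) :=
    Real.summable_one_div_nat_rpow.2 (by norm_num)
  refine ⟨∑' i : ℕ, 1 / (i : ℝ) ^ (3 / 2 : ℝ), tsum_nonneg fun i => by positivity, fun n => ?_⟩
  refine le_trans (le_of_eq ?_) (hs.sum_le_tsum (Finset.Ico 1 n) fun i _ => by positivity)
  refine Finset.sum_congr rfl fun i hi => ?_
  rw [Real.sqrt_eq_rpow, ← Real.rpow_one_add' (by positivity) (by norm_num)]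
  norm_num

/-- If the mean converges at rate `1 / n` after its leading term is removed, the cross terms are
summable enough for `crossSum` to be `O(1 / √n)`. -/
theorem exists_abs_crossSum_le {c₀ C : ℝ} (hC : 0 ≤ C)
    (hd : ∀ n : ℕ, 1 ≤ n → |deviation n - c₀| ≤ C / n) :
    ∃ B : ℝ, 0 ≤ B ∧ ∀ n : ℕ, 2 ≤ n → |crossSum n| ≤ B / √(n : ℝ) := by
  obtain ⟨Z, hZ0, hZ⟩ := exists_sum_one_div_mul_sqrt_le
  have hz := zeta_pos one_lt_two
  set a := (zeta 2)⁻¹ with ha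
  have ha0 : 0 < a := by positivity
  refine ⟨(4 * a * C + 8 * C ^ 2) * Z, by positivity, fun n hn => ?_⟩
  have hn' : (2 : ℝ) ≤ n := by exact_mod_cast hn
  have s2 : 0 < √(n : ℝ) := Real.sqrt_pos.2 (by linarith)
  have q2 : √(n : ℝ) * √(n : ℝ) = n := Real.mul_self_sqrt (by linarith)
  have key : ∀ i ∈ Finset.Ico 1 n,
      |(2 * a * (Real.log n - Real.log i) * (deviation n - deviation i)
        + (deviation n - deviation i) ^ 2) / ((n : ℝ) - i)|
      ≤ (4 * a * C + 8 * C ^ 2) / √(n : ℝ) * (1 / ((i : ℝ) * √(i : ℝ))) := by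
    intro i hi
    have h1 := cast_sub_pos hi
    have h2 := cast_pos_of_mem hi
    have s1 : 0 < √(i : ℝ) := Real.sqrt_pos.2 h2
    have q1 : √(i : ℝ) * √(i : ℝ) = i := Real.mul_self_sqrt h2.le
    have hi' := Finset.mem_Ico.1 hi
    have hi1 : (1 : ℝ) ≤ i := by exact_mod_cast hi'.1
    have hi2 : (1 : ℝ) ≤ (n : ℝ) - i := by
      have : (i : ℝ) + 1 ≤ n := by exact_mod_cast hi'.2
      linarith
    have hη : |deviation n - deviation i| ≤ 2 * C / i := by
      have e : deviation n - deviation i = (deviation n - c₀) - (deviation i - c₀) := by ring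
      have h3 : C / (n : ℝ) ≤ C / i := div_le_div_of_nonneg_left hC h2 (by linarith)
      have e2 : 2 * C / (i : ℝ) = C / i + C / i := by ring
      rw [e, e2]
      exact (abs_sub _ _).trans (add_le_add ((hd n (by omega)).trans h3) (hd i hi'.1))
    have hl := log_sub_log_le hi
    have hl0 : 0 ≤ Real.log n - Real.log i :=
      sub_nonneg.2 (Real.log_le_log h2 (by linarith))
    -- `i (n - i) ≥ n - 1`
    have hprod : √(n : ℝ) / 2 ≤ √(i : ℝ) * ((n : ℝ) - i) := by
      refine (sq_le_sq₀ (by positivity) (by positivity)).1 ?_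
      have : (n : ℝ) - 1 ≤ i * ((n : ℝ) - i) := by nlinarith
      have e1 : (√(n : ℝ) / 2) ^ 2 = n / 4 := by rw [div_pow, sq, q2]; norm_num
      have e2 : (√(i : ℝ) * ((n : ℝ) - i)) ^ 2 = i * ((n : ℝ) - i) * ((n : ℝ) - i) := by
        rw [mul_pow, sq √(i : ℝ), q1]; ring
      rw [e1, e2]
      nlinarith
    rw [abs_div, abs_of_pos h1, div_le_iff₀ h1]
    calc _ ≤ |2 * a * (Real.log n - Real.log i) * (deviation n - deviation i)|
          + |(deviation n - deviation i) ^ 2| := abs_add_le _ _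
      _ = 2 * a * (Real.log n - Real.log i) * |deviation n - deviation i|
          + |deviation n - deviation i| ^ 2 := by
          rw [abs_mul, abs_of_nonneg (by positivity), abs_pow]
      _ ≤ 2 * a * (((n : ℝ) - i) / (√(i : ℝ) * √(n : ℝ))) * (2 * C / i) + (2 * C / i) ^ 2 := by
          gcongr
      _ ≤ (4 * a * C) / √(n : ℝ) * (1 / ((i : ℝ) * √(i : ℝ))) * ((n : ℝ) - i)
          + (8 * C ^ 2) / √(n : ℝ) * (1 / ((i : ℝ) * √(i : ℝ))) * ((n : ℝ) - i) := by
          apply add_le_add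
          · apply le_of_eq
            field_simp
            ring
          · have e : (8 * C ^ 2) / √(n : ℝ) * (1 / ((i : ℝ) * √(i : ℝ))) * ((n : ℝ) - i)
                = (2 * C / i) ^ 2 * (2 * (√(i : ℝ) * ((n : ℝ) - i)) / √(n : ℝ)) := by
              have e3 : 1 / √(i : ℝ) = √(i : ℝ) / i := by
                rw [div_eq_div_iff s1.ne' h2.ne', one_mul, q1]
              rw [one_div, mul_inv, ← one_div √(i : ℝ), e3]
              ring
            rw [e]
            refine le_mul_of_one_le_right (by positivity) ?_
            rw [le_div_iff₀ s2]
            linarith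
      _ = _ := by ring
  calc |crossSum n| ≤ _ := Finset.abs_sum_le_sum_abs _ _
    _ ≤ _ := Finset.sum_le_sum key
    _ = (4 * a * C + 8 * C ^ 2) / √(n : ℝ) * ∑ i ∈ Finset.Ico 1 n, 1 / ((i : ℝ) * √(i : ℝ)) := by
        rw [Finset.mul_sum]
    _ ≤ (4 * a * C + 8 * C ^ 2) / √(n : ℝ) * Z :=
        mul_le_mul_of_nonneg_left (hZ n) (by positivity)
    _ = _ := by ring

theorem abs_h_sub_log_le {n : ℕ} (hn : 2 ≤ n) : |h (n - 1) - Real.log n| ≤ 1 := by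
  have h1 := log_add_one_le_harmonic (n - 1)
  have h2 := harmonic_le_one_add_log (n - 1)
  rw [Nat.sub_add_cancel (by omega)] at h1
  have h3 : Real.log ((n - 1 : ℕ) : ℝ) ≤ Real.log n :=
    Real.log_le_log (by exact_mod_cast (by omega : 0 < n - 1)) (by exact_mod_cast Nat.sub_le n 1)
  unfold h
  rw [abs_le]
  constructor <;> linarith

/-- On a sequence of order `n ^ (-r)`, `r > 1`, `splitOp` is of order `1 / n`. -/
theorem exists_mul_abs_splitOp_le {w : ℕ → ℝ} {C r : ℝ} (hC : 0 ≤ C) (hr : 1 < r)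
    (hw : ∀ n : ℕ, 1 ≤ n → |w n| ≤ C * (n : ℝ) ^ (-r)) :
    ∃ B : ℝ, ∀ n : ℕ, 2 ≤ n → n * |splitOp w n| ≤ B := by
  have hs : Summable fun i : ℕ => (i : ℝ) ^ (-r) := Real.summable_nat_rpow.2 (by linarith)
  set Z := ∑' i : ℕ, (i : ℝ) ^ (-r)
  refine ⟨C * (1 + (2 : ℝ) ^ r) * (2 + 1 / (r - 1)) + 2 * C * Z, fun n hn => ?_⟩
  have hn' : (2 : ℝ) ≤ n := by exact_mod_cast hn
  have hn0 : (0 : ℝ) < n := by linarith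
  have hh0 : 0 < h (n - 1) := h_pos (by omega)
  have hh : h (n - 1) ≤ 1 + Real.log n := by linarith [(abs_le.1 (abs_h_sub_log_le hn)).2]
  have key : ∀ i ∈ Finset.Ico 1 n, |w i / ((n : ℝ) - i)|
      ≤ C * (2 / n) * (i : ℝ) ^ (-r) + C * ((2 : ℝ) ^ r * (n : ℝ) ^ (-r)) * (1 / ((n : ℝ) - i)) := by
    intro i hi
    have h1 := cast_sub_pos hi
    have h2 := cast_pos_of_mem hi
    have h3 : 0 < (i : ℝ) ^ (-r) := Real.rpow_pos_of_pos h2 _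
    have h4 : 0 < (n : ℝ) ^ (-r) := Real.rpow_pos_of_pos hn0 _
    have h5 : 0 < (2 : ℝ) ^ r := Real.rpow_pos_of_pos two_pos _
    rw [abs_div, abs_of_pos h1]
    have h6 : |w i| / ((n : ℝ) - i) ≤ C * (i : ℝ) ^ (-r) * (1 / ((n : ℝ) - i)) := by
      rw [mul_one_div]
      exact div_le_div_of_nonneg_right (hw i (Finset.mem_Ico.1 hi).1) h1.le
    refine h6.trans ?_
    -- for `i ≤ n / 2` the factor `1 / (n - i)` is of order `1 / n`, otherwise `i ^ (-r)` is small
    rcases le_total (i : ℝ) (n / 2) with hle | hle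
    · have h7 : 1 / ((n : ℝ) - i) ≤ 2 / n := by
        rw [div_le_div_iff₀ h1 hn0]; linarith
      have h8 : C * (i : ℝ) ^ (-r) * (1 / ((n : ℝ) - i)) ≤ C * (i : ℝ) ^ (-r) * (2 / n) := by
        gcongr
      have h9 : 0 ≤ C * ((2 : ℝ) ^ r * (n : ℝ) ^ (-r)) * (1 / ((n : ℝ) - i)) := by positivity
      linarith
    · have h7 : (i : ℝ) ^ (-r) ≤ (2 : ℝ) ^ r * (n : ℝ) ^ (-r) := by
        have := Real.rpow_le_rpow_of_nonpos (by positivity) hle (by linarith : -r ≤ 0)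
        rw [Real.div_rpow hn0.le two_pos.le, Real.rpow_neg two_pos.le, div_inv_eq_mul] at this
        linarith
      have h8 : C * (i : ℝ) ^ (-r) * (1 / ((n : ℝ) - i))
          ≤ C * ((2 : ℝ) ^ r * (n : ℝ) ^ (-r)) * (1 / ((n : ℝ) - i)) := by gcongr
      have h9 : 0 ≤ C * (2 / n) * (i : ℝ) ^ (-r) := by positivity
      linarith
  have hpow : (n : ℝ) * (n : ℝ) ^ (-r) = (n : ℝ) ^ (-(r - 1)) := by
    rw [← Real.rpow_one_add' hn0.le (by linarith)]
    congr 1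
    ring
  have hlog : (n : ℝ) * (n : ℝ) ^ (-r) * h (n - 1) ≤ 2 + 1 / (r - 1) := by
    have h1 := Real.log_le_rpow_div hn0.le (by linarith : 0 < r - 1)
    have h2 : 0 < (n : ℝ) ^ (r - 1) := Real.rpow_pos_of_pos hn0 _
    have h3 : 1 ≤ (n : ℝ) ^ (r - 1) := Real.one_le_rpow (by linarith) (by linarith)
    rw [hpow, Real.rpow_neg hn0.le, inv_mul_le_iff₀ h2, mul_add]
    have e : (n : ℝ) ^ (r - 1) * (1 / (r - 1)) = (n : ℝ) ^ (r - 1) / (r - 1) := by ring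
    rw [e]
    linarith
  have htot : |splitOp w n| ≤ h (n - 1) * (C * (n : ℝ) ^ (-r)) + (C * (2 / n) * Z
      + C * ((2 : ℝ) ^ r * (n : ℝ) ^ (-r)) * h (n - 1)) := by
    rw [splitOp_eq]
    refine (abs_sub _ _).trans (add_le_add ?_ ?_)
    · rw [abs_mul, abs_of_pos hh0]
      exact mul_le_mul_of_nonneg_left (hw n (by omega)) hh0.le
    · refine (Finset.abs_sum_le_sum_abs _ _).trans ((Finset.sum_le_sum key).trans ?_)
      rw [Finset.sum_add_distrib, ← Finset.mul_sum, ← Finset.mul_sum, sum_one_div_sub]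
      gcongr
      exact hs.sum_le_tsum _ fun i _ => by positivity
  have e1 : (n : ℝ) * (h (n - 1) * (C * (n : ℝ) ^ (-r)) + (C * (2 / n) * Z
      + C * ((2 : ℝ) ^ r * (n : ℝ) ^ (-r)) * h (n - 1)))
      = C * (1 + (2 : ℝ) ^ r) * ((n : ℝ) * (n : ℝ) ^ (-r) * h (n - 1)) + 2 * C * Z := by
    field_simp
    ring
  calc (n : ℝ) * |splitOp w n| ≤ _ := mul_le_mul_of_nonneg_left htot hn0.le
    _ = _ := e1
    _ ≤ _ := by gcongr

theorem HExpansion.exists_bound {c₀ c₁ r : ℝ} (H : HExpansion c₀ c₁ r) :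
    ∃ C : ℝ, 0 ≤ C ∧ ∀ n : ℕ, 1 ≤ n →
      |deviation n - c₀ - c₁ * (n : ℝ)⁻¹| ≤ C * (n : ℝ) ^ (-r) := by
  obtain ⟨C, hC0, hC⟩ := bound_of_isBigO_nat_atTop H
  refine ⟨C, hC0.le, fun n hn => ?_⟩
  have hn' : (0 : ℝ) < n := by exact_mod_cast hn
  have hp := Real.rpow_pos_of_pos hn' (-r)
  have := hC (x := n) hp.ne'
  rw [Real.norm_of_nonneg hp.le, Real.norm_eq_abs] at this
  refine le_trans (le_of_eq ?_) this
  rw [deviation]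
  congr 1
  ring

/-- The coefficient of `1 / n` is determined by the terms of order `log n / n` in the recursion. -/
theorem HExpansion.coeff_eq {c₀ c₁ r : ℝ} (hr : 1 < r) (H : HExpansion c₀ c₁ r) :
    c₁ = -(1 / (2 * zeta 2)) := by
  have hz := zeta_pos one_lt_two
  obtain ⟨C, hC0, hC⟩ := H.exists_bound
  obtain ⟨B, hB⟩ := exists_mul_abs_splitOp_le hC0 hr hC
  obtain ⟨A, hA0, hA⟩ := exists_abs_splitOp_log_sub
  set κ := 1 / (2 * zeta 2) + c₁ with hκ
  have key : ∀ n : ℕ, 2 ≤ n → |κ| * Real.log n ≤ B + (zeta 2)⁻¹ * A + |c₁| := by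
    intro n hn
    have hn' : (2 : ℝ) ≤ n := by exact_mod_cast hn
    have hn0 : (0 : ℝ) < n := by linarith
    have hL : splitOp (fun n => deviation n - c₀ - c₁ * (n : ℝ)⁻¹) n
        = (zeta 2)⁻¹ * (zeta 2 - splitOp (fun i => Real.log i) n) + c₁ * (h (n - 1) / n) := by
      rw [splitOp_sub (fun n => deviation n - c₀), splitOp_sub deviation, splitOp_const,
        splitOp_const_mul, splitOp_inv (by omega), splitOp_deviation hn]
      ring
    have e : κ * Real.log n = n * splitOp (fun n => deviation n - c₀ - c₁ * (n : ℝ)⁻¹) n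
        + (zeta 2)⁻¹ * (n * (splitOp (fun i => Real.log i) n - (zeta 2 - Real.log n / (2 * n))))
        - c₁ * (h (n - 1) - Real.log n) := by
      rw [hL, hκ]
      field_simp
      ring
    have h1 : |(n : ℝ) * splitOp (fun n => deviation n - c₀ - c₁ * (n : ℝ)⁻¹) n| ≤ B := by
      rw [abs_mul, abs_of_pos hn0]
      exact hB n hn
    have h2 : |(zeta 2)⁻¹ * (n * (splitOp (fun i => Real.log i) n
        - (zeta 2 - Real.log n / (2 * n))))| ≤ (zeta 2)⁻¹ * A := by
      rw [abs_mul, abs_of_pos (inv_pos.2 hz), abs_mul, abs_of_pos hn0]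
      refine mul_le_mul_of_nonneg_left ?_ (inv_pos.2 hz).le
      have := hA n (by omega)
      rwa [le_div_iff₀' hn0] at this
    have h3 : |c₁ * (h (n - 1) - Real.log n)| ≤ |c₁| := by
      rw [abs_mul]
      exact mul_le_of_le_one_right (abs_nonneg _) (abs_h_sub_log_le hn)
    have hlog : 0 ≤ Real.log n := Real.log_nonneg (by linarith)
    calc |κ| * Real.log n = |κ * Real.log n| := by rw [abs_mul, abs_of_nonneg hlog]
      _ ≤ _ := by
        rw [e]
        exact (abs_sub _ _).trans (add_le_add ((abs_add_le _ _).trans (add_le_add h1 h2)) h3)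
  have hκ0 : κ = 0 := by
    by_contra hne
    have hpos : 0 < |κ| := abs_pos.2 hne
    have ht : Tendsto (fun n : ℕ => |κ| * Real.log n) atTop atTop :=
      (Real.tendsto_log_atTop.comp tendsto_natCast_atTop_atTop).const_mul_atTop hpos
    obtain ⟨n, h1, h2⟩ := ((ht.eventually_gt_atTop (B + (zeta 2)⁻¹ * A + |c₁|)).and
      (eventually_ge_atTop 2)).exists
    exact absurd (key n h2) (not_le.2 h1)
  linarith

theorem HExpansion.exists_abs_deviation_sub_le {c₀ c₁ r : ℝ} (hr : 1 < r)
    (H : HExpansion c₀ c₁ r) :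
    ∃ C : ℝ, 0 ≤ C ∧ ∀ n : ℕ, 1 ≤ n → |deviation n - c₀| ≤ C / n := by
  obtain ⟨C, hC0, hC⟩ := H.exists_bound
  refine ⟨C + |c₁|, by positivity, fun n hn => ?_⟩
  have hn' : (1 : ℝ) ≤ n := by exact_mod_cast hn
  have h1 : (n : ℝ) ^ (-r) ≤ (n : ℝ)⁻¹ := by
    rw [← Real.rpow_neg_one]
    exact Real.rpow_le_rpow_of_exponent_le hn' (by linarith)
  calc |deviation n - c₀|
      = |(deviation n - c₀ - c₁ * (n : ℝ)⁻¹) + c₁ * (n : ℝ)⁻¹| := by rw [sub_add_cancel]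
    _ ≤ C * (n : ℝ) ^ (-r) + |c₁| * (n : ℝ)⁻¹ := by
        refine (abs_add_le _ _).trans (add_le_add (hC n hn) (le_of_eq ?_))
        rw [abs_mul, abs_of_nonneg (by positivity : 0 ≤ (n : ℝ)⁻¹)]
    _ ≤ C * (n : ℝ)⁻¹ + |c₁| * (n : ℝ)⁻¹ := by gcongr
    _ = _ := by rw [div_eq_mul_inv]; ring

theorem HExpansion.exists_abs_varD_sub_le {c₀ c₁ r : ℝ} (hr : 1 < r) (H : HExpansion c₀ c₁ r) :
    ∃ C : ℝ, ∀ n : ℕ, 1 ≤ n → |varD n - varConst * Real.log n| ≤ C := by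
  obtain ⟨C, hC0, hC⟩ := H.exists_abs_deviation_sub_le hr
  obtain ⟨B, hB0, hB⟩ := exists_abs_crossSum_le hC0 hC
  obtain ⟨A, hA0, hA⟩ := exists_abs_main_le
  have := abs_le_of_abs_splitOp_le (f := fun i => varD i - varConst * Real.log i)
    (C := A + B) (by positivity) fun n hn => by
      rw [splitOp_varD_sub hn, add_div]
      exact (abs_add_le _ _).trans (add_le_add (hA n hn) (hB n hn))
  exact ⟨_, this⟩

theorem varD_isEquivalent : varD ~[atTop] fun n : ℕ => varConst * Real.log n := by
  have hz2 := zeta_pos one_lt_two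
  have hz3 : 0 < zeta 3 := zeta_pos (by norm_num)
  have hc : 0 < varConst := by unfold varConst; positivity
  refine IsLittleO.of_bound fun c hc0 => ?_
  have hε : 0 < c * varConst / 2 := by positivity
  obtain ⟨C, hC⟩ := exists_abs_varD_sub_le hε
  have ht : Tendsto (fun n : ℕ => c * varConst / 2 * Real.log n) atTop atTop :=
    (Real.tendsto_log_atTop.comp tendsto_natCast_atTop_atTop).const_mul_atTop hε
  filter_upwards [ht.eventually_ge_atTop (C + c * varConst / 2), eventually_ge_atTop 2]
    with n h1 hn
  have hn' : (2 : ℝ) ≤ n := by exact_mod_cast hn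
  have hlog : 0 ≤ Real.log n := Real.log_nonneg (by linarith)
  have h2 := meanD_le hn
  have h3 : Real.log ((n : ℝ) - 1) ≤ Real.log n := Real.log_le_log (by linarith) (by linarith)
  have h4 := hC n (by omega)
  have h5 := mul_le_mul_of_nonneg_left (by linarith : meanD n ≤ 1 + Real.log n) hε.le
  simp only [Pi.sub_apply, Real.norm_eq_abs]
  rw [abs_of_nonneg (by positivity : 0 ≤ varConst * Real.log n)]
  linarith

end BetaSplitting

theorem theorem1p1 :
    -- `D_n` is a square-integrable random variable
    (∀ n : ℕ, 2 ≤ n → IsProbabilityMeasure (BetaSplitting.leafLaw n) ∧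
      MemLp (BetaSplitting.D n) 2 (BetaSplitting.leafLaw n)) ∧
    -- explicit bounds on the mean
    (∀ n : ℕ, 2 ≤ n →
      (BetaSplitting.zeta 2)⁻¹ * Real.log n ≤ BetaSplitting.meanD n ∧
      BetaSplitting.meanD n ≤ 1 + Real.log ((n : ℝ) - 1)) ∧
    -- first-order asymptotics of the mean and of the variance
    ((fun n : ℕ => BetaSplitting.meanD n - (BetaSplitting.zeta 2)⁻¹ * Real.log n)
      =O[atTop] fun _ : ℕ => (1 : ℝ)) ∧
    ((fun n : ℕ => BetaSplitting.varD n)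
      ~[atTop] fun n : ℕ =>
        2 * BetaSplitting.zeta 3 / BetaSplitting.zeta 2 ^ 3 * Real.log n) ∧
    -- sharper expansions, contingent on the ansatz
    (∀ c₀ c₁ r : ℝ, 1 < r → r ≤ 2 → BetaSplitting.HExpansion c₀ c₁ r →
      ((fun n : ℕ => BetaSplitting.meanD n -
          ((BetaSplitting.zeta 2)⁻¹ * Real.log n + c₀
            - 1 / (2 * BetaSplitting.zeta 2) * (n : ℝ)⁻¹))
        =O[atTop] fun n : ℕ => (n : ℝ) ^ (-r)) ∧
      ((fun n : ℕ => BetaSplitting.varD n -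
          2 * BetaSplitting.zeta 3 / BetaSplitting.zeta 2 ^ 3 * Real.log n)
        =O[atTop] fun _ : ℕ => (1 : ℝ))) := by
  refine ⟨fun n hn => ⟨BetaSplitting.isProbabilityMeasure_leafLaw (by omega),
      (BetaSplitting.memLp_D (by omega)).1⟩,
    fun n hn => ⟨BetaSplitting.zeta_inv_mul_log_le (by omega), BetaSplitting.meanD_le hn⟩,
    ?_, BetaSplitting.varD_isEquivalent, fun c₀ c₁ r hr _ H => ⟨?_, ?_⟩⟩
  · obtain ⟨K, _, hK⟩ := BetaSplitting.exists_abs_deviation_le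
    refine IsBigO.of_bound K ?_
    filter_upwards [eventually_ge_atTop 1] with n hn
    simpa [BetaSplitting.deviation] using hK n hn
  · have hc := H.coeff_eq hr
    rw [hc] at H
    refine H.congr_left fun n => ?_
    ring
  · obtain ⟨C, hC⟩ := H.exists_abs_varD_sub_le hr
    refine IsBigO.of_bound C ?_
    filter_upwards [eventually_ge_atTop 1] with n hn
    simpa [BetaSplitting.varConst] using hC n hn
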